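/- Let $b\ge 2$ and let $(V_1,\dots,V_b)$ be the spacings cut out of $(0,1)$ by $b-1$ distinct random division points with an arbitrary joint law, so that $V_j>0$ and $V_1+\dots+V_b=1$ almost surely. Let $F(x)=\mathbb E\,\#\{j: V_j<x\}$ be the expected count function. In the sequential fragmentation with this splitting law one starts from the unit interval and at each step splits a current largest subinterval, of length $M$ say, into $b$ subintervals of lengths $MV_1,\dots,MV_b$, where the vectors of proportions used at different steps are independent copies of $(V_1,\dots,V_b)$. After $n$ splittings let $M_n$ be the largest length and $N_n$ the number of subintervals; let $u_n(x)=\#\{\text{subintervals of length}\le xM_n\}/N_n$ be the empirical spacing distribution function and $m_n$ the mean of the lengths divided by $M_n$ (the current largest spacing is the unit of length). For $C>0$ put $$u_C(x)=C\,x^{-C(b-1)}\int_0^x F(s)\,s^{C(b-1)-1}\,ds ,\qquad 0<x\le 1 .$$ Then: (i) There is exactly one $C>0$ with $u_C(1)=1$; for this $C$, the left derivative of $u_C$ at $1$ equals $C$. Fix this $C$. (ii) Almost surely, the spacing distribution is stationary (there is a function $u$ with $u_n(x)\to u(x)$ for every $x\in(0,1]$) if and only if the mean spacing is stationary ($m_n$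 converges to some real number); and in that case $u=u_C$ on $(0,1]$. (iii) The same holds for the feedback equation of the evolving spacing distribution. Let $u(x,t)$ be a function with continuous partial derivatives on $(0,1]\times[0,\infty)$ (one-sided at the boundary) that satisfies $$x\,\frac{\partial u}{\partial x}+\frac{\partial u}{\partial t}=u_x(1,t)\bigl(-(b-1)\,u(x,t)+F(x)\bigr),$$ and suppose that, for every $t\ge0$, $u(\cdot,t)$ is a distribution function on $(0,1]$, that is, nondecreasing with $u(0+,t)=0$ and $u(1,t)=1$. Then $u(x,t)$ does not depend on $t$ if and only if the mean spacing $\int_0^1 x\,u_x(x,t)\,dx$ does not depend on $t$; and in that case $u(x,t)=u_C(x)$ and $u_x(1,t)=C$ for all $x\in(0,1]$, $t\ge0$. -/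

import Mathlib

open Set Filter Topology MeasureTheory ProbabilityTheory

noncomputable section

namespace SeqFrag

/-! ### The splitting law -/

/-- `ν` is the law of the `b` spacings `(V₁, …, V_b)` cut out of the unit interval by `b - 1`
(arbitrarily distributed, distinct) division points: almost surely the spacings are positive and
add up to `1`. -/
structure IsSplittingLaw {b : ℕ} (ν : Measure (Fin b → ℝ)) : Prop where
  prob : IsProbabilityMeasure ν
  pos : ∀ᵐ v ∂ν, ∀ j, 0 < v j
  sum_eq_one : ∀ᵐ v ∂ν, ∑ j, v j = 1

/-- `ξ(x)`, the number of spacings shorter than `x`. -/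
def splitCount {b : ℕ} (v : Fin b → ℝ) (x : ℝ) : ℕ :=
  (Finset.univ.filter fun j => v j < x).card

/-- The expected count function `F(x) = 𝔼 ξ(x)`. -/
def expectedCount {b : ℕ} (ν : Measure (Fin b → ℝ)) (x : ℝ) : ℝ :=
  ∫ v, (splitCount v x : ℝ) ∂ν

/-! ### The sequential fragmentation -/

/-- The largest of a finite collection of nonnegative lengths. -/
def largest (s : Multiset ℝ) : ℝ := s.fold max 0

/-- Lengths of the subintervals after `n` splittings of `(0, 1)`. At each step one subinterval of
maximal length `M` is replaced by `b` subintervals of lengths `M * v n j`, where `v n` is the vector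
of proportions drawn for that step. -/
def spacings {b : ℕ} (v : ℕ → Fin b → ℝ) : ℕ → Multiset ℝ
  | 0 => {1}
  | n + 1 =>
      (spacings v n).erase (largest (spacings v n)) +
        (Finset.univ : Finset (Fin b)).val.map fun j => largest (spacings v n) * v n j

/-- Empirical distribution function of the spacings after `n` splittings, the current largest
spacing being taken as the unit of length. -/
def empiricalCDF {b : ℕ} (v : ℕ → Fin b → ℝ) (n : ℕ) (x : ℝ) : ℝ :=
  (((spacings v n).filter fun l => l ≤ x * largest (spacings v n)).card : ℝ) /
    ((spacings v n).card : ℝ)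

/-- Mean spacing after `n` splittings, the current largest spacing being taken as the unit. -/
def meanSpacing {b : ℕ} (v : ℕ → Fin b → ℝ) (n : ℕ) : ℝ :=
  ((spacings v n).map fun l => l / largest (spacings v n)).sum / ((spacings v n).card : ℝ)

/-- `u` is the limiting spacing distribution function on `(0, 1]`. -/
def IsLimitingCDF {b : ℕ} (v : ℕ → Fin b → ℝ) (u : ℝ → ℝ) : Prop :=
  ∀ x ∈ Ioc (0 : ℝ) 1, Tendsto (fun n => empiricalCDF v n x) atTop (𝓝 (u x))

/-- The spacing distribution is stationary: it converges as the number of splittings grows. -/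
def SpacingDistributionStationary {b : ℕ} (v : ℕ → Fin b → ℝ) : Prop :=
  ∃ u : ℝ → ℝ, IsLimitingCDF v u

/-- The mean spacing is stationary: it converges as the number of splittings grows. -/
def MeanSpacingStationary {b : ℕ} (v : ℕ → Fin b → ℝ) : Prop :=
  ∃ m : ℝ, Tendsto (meanSpacing v) atTop (𝓝 m)

/-! ### The explicit distribution function -/

/-- `C x^{-C(b-1)} ∫₀ˣ F(s) s^{C(b-1)-1} ds` -/
def stationaryCDF (b : ℕ) (F : ℝ → ℝ) (C x : ℝ) : ℝ :=
  C * x ^ (-(C * ((b : ℝ) - 1))) * ∫ s in (0 : ℝ)..x, F s * s ^ (C * ((b : ℝ) - 1) - 1)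

/-! ### The feedback equation -/

/-- `u(x, t)`, with continuous partial derivatives `ux` and `ut`, is a classical solution on
`(0, 1] × [0, ∞)` of
`x ∂u/∂x + ∂u/∂t = u_x(1, t) (-(b - 1) u + F(x))`,
and every `u(·, t)` is the distribution function of a law on `(0, 1]`. -/
structure IsFeedbackSolution (b : ℕ) (F : ℝ → ℝ) (u ux ut : ℝ → ℝ → ℝ) : Prop where
  hasDeriv_x : ∀ x ∈ Ioc (0 : ℝ) 1, ∀ t ∈ Ici (0 : ℝ),
    HasDerivWithinAt (fun y => u y t) (ux x t) (Ioc 0 1) x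
  hasDeriv_t : ∀ x ∈ Ioc (0 : ℝ) 1, ∀ t ∈ Ici (0 : ℝ),
    HasDerivWithinAt (fun s => u x s) (ut x t) (Ici 0) t
  cont_x : ContinuousOn (fun p : ℝ × ℝ => ux p.1 p.2) (Ioc 0 1 ×ˢ Ici 0)
  cont_t : ContinuousOn (fun p : ℝ × ℝ => ut p.1 p.2) (Ioc 0 1 ×ˢ Ici 0)
  equation : ∀ x ∈ Ioc (0 : ℝ) 1, ∀ t ∈ Ici (0 : ℝ),
    x * ux x t + ut x t = ux 1 t * (-((b : ℝ) - 1) * u x t + F x)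
  mono : ∀ t ∈ Ici (0 : ℝ), MonotoneOn (fun x => u x t) (Ioc 0 1)
  at_zero : ∀ t ∈ Ici (0 : ℝ), Tendsto (fun x => u x t) (𝓝[>] 0) (𝓝 0)
  at_one : ∀ t ∈ Ici (0 : ℝ), u 1 t = 1

end SeqFrag

end

/-! The constant is `C = 1/(b-1)`. By Fubini, `u_C(1) = 1` says that the moment `E ∑ V_j^p` equals
`1` for `p = C(b-1)`. This moment is strictly decreasing in `p` and equals `1` at `p = 1`
(`IsSplittingLaw.normalization_iff`). Hence `∫₀¹ F = b - 1` and `u_C(x) = ((b-1)x)⁻¹ ∫₀ˣ F`.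

Fragmentation. The mean is `1 - ∫₀¹ u_n`, so convergence of the distribution passes to the mean by
dominated convergence. Conversely, the lengths add up to `1`, so `m_n = 1/(M_n N_n)` with `N_n = 1 +
n(b-1)`. If `m_n` converges, its limit is positive, and `M_n / M_{⌊an⌋} → a`
(`tendsto_largest_ratio`). An interval shorter than `M_n` has never been split, so the number of
lengths `≤ x M_n` is the sum over `k < n` of the number of `j` with `V_{k,j} ≤ x M_n / M_k ≈ x k/n`.
By the strong law on blocks of indices `k`, this is about `n ∫₀¹ F(xa) da = n x⁻¹ ∫₀ˣ F`
(`tendsto_card_filter_div`).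

Feedback equation. Put `g(t) = u_x(1,t)` and let `m` be the mean. Integrating the equation over `x`
gives `d/dt ∫ u = m (g(b-1) - 1)`, so a constant mean forces `g = 1/(b-1)`
(`ux_one_eq_of_mean_const`). Then `x u` has derivative `F/(b-1)` along characteristics, which reach
`x = 1`, where `u = 1`; this determines `u` without initial data (`eq_of_ux_one_eq`). A stationary
`u` solves a linear ODE whose solution is `u_g`, and `u_g(1) = 1` gives `g = C`. -/

noncomputable section

namespace SeqFrag

/-! ### Deterministic structure of the fragmentation for a fixed sequence of proportions -/

section

/-! ### The lengths of the subintervals -/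

theorem largest_cons (a : ℝ) (s : Multiset ℝ) : largest (a ::ₘ s) = max a (largest s) :=
  Multiset.fold_cons_left max 0 a s

theorem largest_nonneg (s : Multiset ℝ) : 0 ≤ largest s := by
  induction s using Multiset.induction_on with
  | empty => simp [largest]
  | cons a s ih => rw [largest_cons]; exact le_max_of_le_right ih

theorem le_largest {s : Multiset ℝ} {a : ℝ} (ha : a ∈ s) : a ≤ largest s := by
  induction s using Multiset.induction_on with
  | empty => simp at ha
  | cons c s ih =>
    rw [largest_cons]
    rcases Multiset.mem_cons.1 ha with rfl | h
    · exact le_max_left _ _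
    · exact le_max_of_le_right (ih h)

theorem largest_le {s : Multiset ℝ} {c : ℝ} (hc : 0 ≤ c) (h : ∀ a ∈ s, a ≤ c) :
    largest s ≤ c := by
  induction s using Multiset.induction_on with
  | empty => simpa [largest] using hc
  | cons a s ih =>
    rw [largest_cons]
    exact max_le (h a (Multiset.mem_cons_self a s))
      (ih fun x hx => h x (Multiset.mem_cons_of_mem hx))

theorem largest_mem {s : Multiset ℝ} (h0 : s ≠ 0) (hs : ∀ a ∈ s, 0 < a) : largest s ∈ s := by
  induction s using Multiset.induction_on with
  | empty => exact absurd rfl h0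
  | cons a s ih =>
    rw [largest_cons]
    by_cases hs0 : s = 0
    · subst hs0
      have ha := hs a (Multiset.mem_cons_self a 0)
      simp [largest, max_eq_left ha.le]
    · rcases max_choice a (largest s) with h | h
      · rw [h]; exact Multiset.mem_cons_self a s
      · rw [h]
        exact Multiset.mem_cons_of_mem (ih hs0 fun x hx => hs x (Multiset.mem_cons_of_mem hx))

variable {b : ℕ} {v : ℕ → Fin b → ℝ}

theorem mem_spacings_succ {n : ℕ} {a : ℝ} (ha : a ∈ spacings v (n + 1)) :
    a ∈ spacings v n ∨ ∃ j, a = largest (spacings v n) * v n j := by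
  rcases Multiset.mem_add.1 ha with h | h
  · exact Or.inl (Multiset.mem_of_mem_erase h)
  · obtain ⟨j, -, rfl⟩ := Multiset.mem_map.1 h
    exact Or.inr ⟨j, rfl⟩

theorem spacings_pos_and_nonempty (hb : 2 ≤ b) (hv : ∀ n j, 0 < v n j) (n : ℕ) :
    (∀ a ∈ spacings v n, 0 < a) ∧ spacings v n ≠ 0 := by
  induction n with
  | zero => simp [spacings]
  | succ n ih =>
    have hM := ih.1 _ (largest_mem ih.2 ih.1)
    refine ⟨fun a ha => ?_, fun h => ?_⟩
    · rcases mem_spacings_succ ha with h | ⟨j, rfl⟩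
      · exact ih.1 a h
      · exact mul_pos hM (hv n j)
    · have h2 := congrArg Multiset.card h
      simp only [spacings, Multiset.card_add, Multiset.card_map, Multiset.card_zero,
        Finset.card_val, Finset.card_univ, Fintype.card_fin] at h2
      omega

theorem spacings_pos (hb : 2 ≤ b) (hv : ∀ n j, 0 < v n j) {n : ℕ} {a : ℝ}
    (ha : a ∈ spacings v n) : 0 < a :=
  (spacings_pos_and_nonempty hb hv n).1 a ha

theorem largest_mem_spacings (hb : 2 ≤ b) (hv : ∀ n j, 0 < v n j) (n : ℕ) :
    largest (spacings v n) ∈ spacings v n :=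
  largest_mem (spacings_pos_and_nonempty hb hv n).2 (spacings_pos_and_nonempty hb hv n).1

theorem largest_spacings_pos (hb : 2 ≤ b) (hv : ∀ n j, 0 < v n j) (n : ℕ) :
    0 < largest (spacings v n) :=
  spacings_pos hb hv (largest_mem_spacings hb hv n)

theorem card_spacings (hb : 2 ≤ b) (hv : ∀ n j, 0 < v n j) (n : ℕ) :
    ((spacings v n).card : ℝ) = 1 + n * ((b : ℝ) - 1) := by
  induction n with
  | zero => simp [spacings]
  | succ n ih =>
    have hmem := largest_mem_spacings hb hv n
    have h : (spacings v (n + 1)).card + 1 = (spacings v n).card + b := by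
      have h1 := Multiset.card_erase_add_one hmem
      simp only [spacings, Multiset.card_add, Multiset.card_map, Finset.card_val,
        Finset.card_univ, Fintype.card_fin]
      omega
    have h' : ((spacings v (n + 1)).card : ℝ) + 1 = (spacings v n).card + b := by exact_mod_cast h
    push_cast
    linarith

theorem sum_spacings (hb : 2 ≤ b) (hv : ∀ n j, 0 < v n j) (hs : ∀ n, ∑ j, v n j = 1) (n : ℕ) :
    (spacings v n).sum = 1 := by
  induction n with
  | zero => simp [spacings]
  | succ n ih =>
    have h1 := Multiset.sum_erase (largest_mem_spacings hb hv n)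
    have h2 : ((Finset.univ : Finset (Fin b)).val.map
        fun j => largest (spacings v n) * v n j).sum = largest (spacings v n) := by
      change ∑ j, largest (spacings v n) * v n j = _
      rw [← Finset.mul_sum, hs, mul_one]
    rw [spacings, Multiset.sum_add, h2, add_comm, h1, ih]

theorem proportion_le_one (hv : ∀ n j, 0 < v n j) (hs : ∀ n, ∑ j, v n j = 1) (n : ℕ)
    (j : Fin b) : v n j ≤ 1 := by
  rw [← hs n]
  exact Finset.single_le_sum (f := v n) (fun i _ => (hv n i).le) (Finset.mem_univ j)

theorem largest_spacings_antitone (hv : ∀ n j, 0 < v n j) (hs : ∀ n, ∑ j, v n j = 1) :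
    Antitone fun n => largest (spacings v n) := by
  refine antitone_nat_of_succ_le fun n => largest_le (largest_nonneg _) fun a ha => ?_
  rcases mem_spacings_succ ha with h | ⟨j, rfl⟩
  · exact le_largest h
  · exact mul_le_of_le_one_right (largest_nonneg _) (proportion_le_one hv hs n j)

/-- Since the lengths add up to `1`, the mean determines the largest length; a convergent mean
therefore fixes the asymptotics of `largest`. -/
theorem meanSpacing_eq (hb : 2 ≤ b) (hv : ∀ n j, 0 < v n j) (hs : ∀ n, ∑ j, v n j = 1) (n : ℕ) :
    meanSpacing v n = (largest (spacings v n) * (1 + n * ((b : ℝ) - 1)))⁻¹ := by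
  have h : ((spacings v n).map fun l => l / largest (spacings v n)).sum
      = (largest (spacings v n))⁻¹ := by
    have := Multiset.sum_map_mul_right (s := spacings v n) (f := fun l => l)
      (a := (largest (spacings v n))⁻¹)
    simp only [Multiset.map_id', sum_spacings hb hv hs n, one_mul] at this
    simpa only [div_eq_mul_inv] using this
  rw [meanSpacing, h, card_spacings hb hv, mul_inv, div_eq_mul_inv]

/-- Subintervals shorter than the current largest one have never been split. -/
theorem card_filter_le_spacings (hb : 2 ≤ b) (hv : ∀ n j, 0 < v n j) (hs : ∀ n, ∑ j, v n j = 1)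
    (n : ℕ) {y : ℝ} (hy : y < largest (spacings v n)) :
    ((spacings v n).filter fun l => l ≤ y).card
      = ∑ k ∈ Finset.range n,
        (Finset.univ.filter fun j => largest (spacings v k) * v k j ≤ y).card := by
  induction n with
  | zero =>
    have : ¬ (1 : ℝ) ≤ y := by
      rw [spacings, ← Multiset.cons_zero, largest_cons] at hy
      simpa [largest] using hy
    simp [spacings, Multiset.filter_singleton, this]
  | succ n ih =>
    have hy' : y < largest (spacings v n) :=
      hy.trans_le (largest_spacings_antitone hv hs (Nat.le_succ n))
    rw [Finset.sum_range_succ, ← ih hy']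
    rw [spacings, Multiset.filter_add, Multiset.card_add]
    congr 1
    -- The interval being split exceeds `y`, so removing it leaves the count unchanged.
    · have := Multiset.cons_erase (largest_mem_spacings hb hv n)
      conv_rhs => rw [← this, Multiset.filter_cons_of_neg (p := fun l => l ≤ y) _ (not_le.2 hy')]
    · rw [Multiset.filter_map, Multiset.card_map]
      rfl

/-! ### The mean spacing as an integral of the empirical distribution function -/

theorem empiricalCDF_mem_Icc (n : ℕ) (x : ℝ) : empiricalCDF v n x ∈ Icc (0 : ℝ) 1 := by
  refine ⟨by unfold empiricalCDF; positivity, div_le_one_of_le₀ ?_ (by positivity)⟩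
  exact_mod_cast Multiset.card_le_card (Multiset.filter_le _ _)

theorem empiricalCDF_mono (n : ℕ) : Monotone (empiricalCDF v n) := by
  intro x y hxy
  unfold empiricalCDF
  gcongr
  refine Multiset.monotone_filter_right _ fun l hl => hl.trans ?_
  exact mul_le_mul_of_nonneg_right hxy (largest_nonneg _)

theorem empiricalCDF_one (hb : 2 ≤ b) (hv : ∀ n j, 0 < v n j) (n : ℕ) :
    empiricalCDF v n 1 = 1 := by
  unfold empiricalCDF
  rw [Multiset.filter_eq_self.2 fun l hl => by rw [one_mul]; exact le_largest hl]
  refine div_self ?_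
  have := (spacings_pos_and_nonempty hb hv n).2
  simpa using this

theorem card_filter_intervalIntegrable (s : Multiset ℝ) {M : ℝ} (hM : 0 < M) :
    IntervalIntegrable (fun x : ℝ => ((s.filter fun l => l ≤ x * M).card : ℝ)) volume 0 1 := by
  refine Monotone.intervalIntegrable fun x y hxy => ?_
  refine Nat.cast_le.2 (Multiset.card_le_card
    (Multiset.monotone_filter_right _ fun l hl => hl.trans ?_))
  exact mul_le_mul_of_nonneg_right hxy hM.le

/-- Each length `l` contributes the indicator of `[l/M, 1]`, whose integral is `1 - l/M`. -/
theorem integral_card_filter (s : Multiset ℝ) {M : ℝ} (hM : 0 < M)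
    (hs : ∀ l ∈ s, 0 < l ∧ l ≤ M) :
    ∫ x in (0 : ℝ)..1, ((s.filter fun l => l ≤ x * M).card : ℝ)
      = s.card - (s.map fun l => l / M).sum := by
  induction s using Multiset.induction_on with
  | empty => simp
  | cons a s ih =>
    have ha := hs a (Multiset.mem_cons_self a s)
    have h1 : ∀ x : ℝ, (((a ::ₘ s).filter fun l => l ≤ x * M).card : ℝ)
        = (Ici (a / M)).indicator (fun _ => (1 : ℝ)) x
          + ((s.filter fun l => l ≤ x * M).card : ℝ) := by
      intro x
      by_cases h : a ≤ x * M
      · rw [Multiset.filter_cons_of_pos (p := fun l => l ≤ x * M) _ h,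
          indicator_of_mem (show x ∈ Ici (a / M) from (div_le_iff₀ hM).2 h), Multiset.card_cons]
        push_cast; ring
      · rw [Multiset.filter_cons_of_neg (p := fun l => l ≤ x * M) _ h,
          indicator_of_notMem (fun h' : x ∈ Ici (a / M) => h ((div_le_iff₀ hM).1 h')), zero_add]
    have h2 : IntervalIntegrable ((Ici (a / M)).indicator fun _ => (1 : ℝ)) volume 0 1 := by
      refine Monotone.intervalIntegrable fun x y hxy => ?_
      by_cases hx : x ∈ Ici (a / M)
      · rw [indicator_of_mem hx,
          indicator_of_mem (show y ∈ Ici (a / M) from le_trans (mem_Ici.1 hx) hxy)]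
      · rw [indicator_of_notMem hx]; exact indicator_nonneg (fun _ _ => zero_le_one) _
    have h3 : ∫ x in (0 : ℝ)..1, (Ici (a / M)).indicator (fun _ => (1 : ℝ)) x = 1 - a / M := by
      have ha0 : 0 < a / M := div_pos ha.1 hM
      have ha1 : a / M ≤ 1 := (div_le_one hM).2 ha.2
      rw [intervalIntegral.integral_of_le zero_le_one, integral_indicator measurableSet_Ici,
        Measure.restrict_restrict measurableSet_Ici]
      have : Ici (a / M) ∩ Ioc 0 1 = Icc (a / M) 1 := by
        ext x; simp only [mem_inter_iff, mem_Ici, mem_Ioc, mem_Icc]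
        exact ⟨fun h => ⟨h.1, h.2.2⟩, fun h => ⟨h.1, ha0.trans_le h.1, h.2⟩⟩
      rw [this]
      simp [ha1]
    simp_rw [h1]
    rw [intervalIntegral.integral_add h2 (card_filter_intervalIntegrable s hM), h3,
      ih fun l hl => hs l (Multiset.mem_cons_of_mem hl)]
    simp only [Multiset.card_cons, Multiset.map_cons, Multiset.sum_cons]
    push_cast; ring

theorem meanSpacing_eq_integral (hb : 2 ≤ b) (hv : ∀ n j, 0 < v n j) (n : ℕ) :
    meanSpacing v n = 1 - ∫ x in (0 : ℝ)..1, empiricalCDF v n x := by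
  have hM := largest_spacings_pos hb hv n
  have h := integral_card_filter (spacings v n) hM
    fun l hl => ⟨spacings_pos hb hv hl, le_largest hl⟩
  have hc : ((spacings v n).card : ℝ) ≠ 0 := by
    simpa using (spacings_pos_and_nonempty hb hv n).2
  simp only [empiricalCDF, intervalIntegral.integral_div, h, meanSpacing]
  field_simp
  ring

theorem meanSpacingStationary_of_spacingDistributionStationary (hb : 2 ≤ b)
    (hv : ∀ n j, 0 < v n j) (h : SpacingDistributionStationary v) : MeanSpacingStationary v := by
  obtain ⟨u, hu⟩ := h
  refine ⟨1 - ∫ x in (0 : ℝ)..1, u x, ?_⟩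
  rw [show meanSpacing v = fun n => 1 - ∫ x in (0 : ℝ)..1, empiricalCDF v n x from
    funext (meanSpacing_eq_integral hb hv)]
  refine tendsto_const_nhds.sub ?_
  refine intervalIntegral.tendsto_integral_filter_of_dominated_convergence (fun _ => 1)
    (Eventually.of_forall fun n => (empiricalCDF_mono n).measurable.aestronglyMeasurable)
    (Eventually.of_forall fun n => ae_of_all _ fun x _ => ?_) (by simp)
    (ae_of_all _ fun x hx => hu x (by simpa using hx))
  rw [Real.norm_of_nonneg (empiricalCDF_mem_Icc n x).1]
  exact (empiricalCDF_mem_Icc n x).2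

end

/-! ### From a convergent mean to a convergent distribution, given the averages of `splitCount` -/

section

/-! ### Cesàro averages along proportional blocks -/

theorem tendsto_floor_mul_atTop {a : ℝ} (ha : 0 < a) :
    Tendsto (fun n : ℕ => ⌊a * n⌋₊) atTop atTop :=
  tendsto_nat_floor_atTop.comp (tendsto_natCast_atTop_atTop.const_mul_atTop ha)

theorem tendsto_floor_mul_div {a : ℝ} (ha : 0 ≤ a) :
    Tendsto (fun n : ℕ => (⌊a * n⌋₊ : ℝ) / n) atTop (𝓝 a) :=
  (tendsto_nat_floor_mul_div_atTop ha).comp tendsto_natCast_atTop_atTop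

theorem tendsto_floor_mul_div_of_tendsto_div {S : ℕ → ℝ} {L a : ℝ} (h0 : S 0 = 0)
    (hS : Tendsto (fun n : ℕ => S n / n) atTop (𝓝 L)) (ha : 0 ≤ a) :
    Tendsto (fun n : ℕ => S ⌊a * n⌋₊ / n) atTop (𝓝 (a * L)) := by
  -- For `a = 0` the index stays at `0`, and `S 0 = 0` is what is needed; this case serves the left
  -- end of the first block.
  rcases ha.eq_or_lt with rfl | ha'
  · simp [h0]
  · have h1 := (tendsto_floor_mul_div ha).mul (hS.comp (tendsto_floor_mul_atTop ha'))
    refine h1.congr' ?_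
    filter_upwards [(tendsto_floor_mul_atTop ha').eventually_gt_atTop 0] with n hn
    have : (⌊a * n⌋₊ : ℝ) ≠ 0 := by positivity
    simp only [Function.comp_apply]
    field_simp

theorem sum_range_eq_sum_blocks (g : ℕ → ℝ) {f : ℕ → ℕ} (hf : Monotone f) (h0 : f 0 = 0) (K : ℕ) :
    ∑ k ∈ Finset.range (f K), g k
      = ∑ i ∈ Finset.range K, ∑ k ∈ Finset.Ico (f i) (f (i + 1)), g k := by
  induction K with
  | zero => simp [h0]
  | succ K ih =>
    rw [Finset.sum_range_succ, ← ih, Finset.sum_range_add_sum_Ico _ (hf (Nat.le_succ K))]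

theorem floor_blocks_monotone (K n : ℕ) : Monotone fun i : ℕ => ⌊(i / K : ℝ) * n⌋₊ := by
  intro i j hij
  dsimp only
  gcongr

/-- A block sum is a difference of two partial sums, so each of the `K` blocks has asymptotic weight
`1/K` and may use its own threshold `q i`. -/
theorem tendsto_block_sum_div {s : ℕ → ℚ → ℝ} {F : ℝ → ℝ}
    (hL : ∀ q : ℚ, Tendsto (fun n : ℕ => (∑ k ∈ Finset.range n, s k q) / n) atTop (𝓝 (F q)))
    {K : ℕ} (q : ℕ → ℚ) :
    Tendsto (fun n : ℕ => (∑ i ∈ Finset.range K,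
        ∑ k ∈ Finset.Ico ⌊(i / K : ℝ) * n⌋₊ ⌊((i + 1 : ℕ) / K : ℝ) * n⌋₊, s k (q i)) / n)
      atTop (𝓝 ((∑ i ∈ Finset.range K, F (q i)) / K)) := by
  simp_rw [Finset.sum_div]
  refine tendsto_finsetSum _ fun i _ => ?_
  have h1 := (tendsto_floor_mul_div_of_tendsto_div (by simp) (hL (q i))
    (show (0 : ℝ) ≤ (i + 1 : ℕ) / K by positivity)).sub
    (tendsto_floor_mul_div_of_tendsto_div (by simp) (hL (q i))
      (show (0 : ℝ) ≤ i / K by positivity))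
  have h2 : ((i + 1 : ℕ) / K : ℝ) * F (q i) - (i / K : ℝ) * F (q i) = F (q i) / K := by
    push_cast; ring
  rw [h2] at h1
  refine h1.congr fun n => ?_
  rw [← Finset.sum_div, Finset.sum_Ico_eq_sub _ (floor_blocks_monotone K n (Nat.le_succ i)),
    sub_div]

/-! ### Riemann sums of bounded monotone functions -/

/-- A shift by one drops a first term that is `≥ 0` and adds a last term that is `≤ B`. -/
theorem sum_shift_two_le {φ : ℝ → ℝ} {B : ℝ} (h0 : ∀ x, 0 ≤ φ x) (hB : ∀ x, φ x ≤ B) (K : ℕ)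
    (c : ℝ) :
    ∑ i ∈ Finset.range K, φ (i + c + 2) ≤ ∑ i ∈ Finset.range K, φ (i + c) + 2 * B := by
  have key : ∀ d : ℝ, ∑ i ∈ Finset.range K, φ (i + d + 1)
      ≤ ∑ i ∈ Finset.range K, φ (i + d) + B := by
    intro d
    have h := Finset.sum_range_sub (fun i : ℕ => φ (i + d)) K
    rw [Finset.sum_sub_distrib] at h
    have h' : ∑ i ∈ Finset.range K, φ (((i + 1 : ℕ) : ℝ) + d)
        = ∑ i ∈ Finset.range K, φ (i + d + 1) :=
      Finset.sum_congr rfl fun i _ => by push_cast; ring_nf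
    rw [h'] at h
    linarith [h0 (((0 : ℕ) : ℝ) + d), hB (K + d)]
  have h1 := key c
  have h2 := key (c + 1)
  have h3 : ∑ i ∈ Finset.range K, φ (i + (c + 1) + 1) = ∑ i ∈ Finset.range K, φ (i + c + 2) :=
    Finset.sum_congr rfl fun i _ => by ring_nf
  have h4 : ∑ i ∈ Finset.range K, φ (i + (c + 1)) = ∑ i ∈ Finset.range K, φ (i + c + 1) :=
    Finset.sum_congr rfl fun i _ => by ring_nf
  linarith

/-- The nodes `i + 2` and `i - 1` lie one step outside the usual right and left nodes. This leaves
room for rational thresholds, at a cost of at most `2B/K`. -/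
theorem riemann_sum_bounds {F : ℝ → ℝ} {B x : ℝ} (hF : Monotone F) (h0 : ∀ y, 0 ≤ F y)
    (hB : ∀ y, F y ≤ B) (hx : 0 < x) {K : ℕ} (hK : 0 < K) :
    (∑ i ∈ Finset.range K, F ((i + 2) * (x / K))) / K
        ≤ x⁻¹ * (∫ s in (0 : ℝ)..x, F s) + 2 * B / K ∧
      x⁻¹ * (∫ s in (0 : ℝ)..x, F s) - 2 * B / K
        ≤ (∑ i ∈ Finset.range K, F ((i - 1) * (x / K))) / K := by
  have hK' : (0 : ℝ) < K := Nat.cast_pos.2 hK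
  set φ : ℝ → ℝ := fun s => F (s * (x / K)) with hφ
  have hmono : Monotone φ := fun s t hst => hF (by gcongr)
  have hFTC : ∫ s in (0 : ℝ)..K, φ s = K * (x⁻¹ * ∫ s in (0 : ℝ)..x, F s) := by
    rw [hφ, intervalIntegral.integral_comp_mul_right _ (by positivity), smul_eq_mul, zero_mul,
      mul_div_cancel₀ _ hK'.ne']
    field_simp
  have lo := MonotoneOn.sum_le_integral (x₀ := 0) (a := K) (hmono.monotoneOn _)
  have up := MonotoneOn.integral_le_sum (x₀ := 0) (a := K) (hmono.monotoneOn _)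
  simp only [zero_add, hFTC] at lo up
  have s1 := sum_shift_two_le (φ := φ) (fun _ => h0 _) (fun _ => hB _) K 0
  have s2 := sum_shift_two_le (φ := φ) (fun _ => h0 _) (fun _ => hB _) K (-1)
  have e1 : ∑ i ∈ Finset.range K, φ (i + 0 + 2) = ∑ i ∈ Finset.range K, F ((i + 2) * (x / K)) :=
    Finset.sum_congr rfl fun i _ => by simp only [hφ, add_zero]
  have e2 : ∑ i ∈ Finset.range K, φ (i + -1) = ∑ i ∈ Finset.range K, F ((i - 1) * (x / K)) :=
    Finset.sum_congr rfl fun i _ => by simp only [hφ, sub_eq_add_neg]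
  have e3 : ∑ i ∈ Finset.range K, φ (i + -1 + 2) = ∑ i ∈ Finset.range K, φ (i + 1 : ℕ) :=
    Finset.sum_congr rfl fun i _ => by push_cast; ring_nf
  rw [e1] at s1
  simp only [add_zero] at s1
  rw [e2, e3] at s2
  constructor
  · rw [div_le_iff₀ hK', add_mul, div_mul_cancel₀ _ hK'.ne']; linarith
  · rw [le_div_iff₀ hK', sub_mul, div_mul_cancel₀ _ hK'.ne']; linarith

/-! ### Convergence of the empirical distribution functions -/

variable {b : ℕ} {v : ℕ → Fin b → ℝ} {F : ℝ → ℝ}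

theorem card_le_splitCount {M y q : ℝ} {w : Fin b → ℝ} (hM : 0 < M) (h : y < q * M) :
    (Finset.univ.filter fun j => M * w j ≤ y).card ≤ splitCount w q := by
  refine Finset.card_le_card fun j hj => ?_
  simp only [Finset.mem_filter, Finset.mem_univ, true_and] at hj ⊢
  exact lt_of_mul_lt_mul_left (by linarith) hM.le

theorem splitCount_le_card {M y q : ℝ} {w : Fin b → ℝ} (hM : 0 < M) (h : q * M ≤ y) :
    splitCount w q ≤ (Finset.univ.filter fun j => M * w j ≤ y).card := by
  refine Finset.card_le_card fun j hj => ?_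
  simp only [Finset.mem_filter, Finset.mem_univ, true_and] at hj ⊢
  nlinarith

/-- The mean spacing stays away from `0`. -/
theorem meanSpacing_eventually_ge (hb : 2 ≤ b) (hv : ∀ n j, 0 < v n j) (hs : ∀ n, ∑ j, v n j = 1)
    (hL : ∀ q : ℚ, Tendsto (fun n : ℕ => (∑ k ∈ Finset.range n, (splitCount (v k) q : ℝ)) / n)
      atTop (𝓝 (F q)))
    {δ : ℚ} (hδ0 : 0 < δ) (hδ1 : δ < 1) (hFδ : F δ ≤ 1 / 2) :
    ∀ᶠ n in atTop, (δ : ℝ) / 8 ≤ meanSpacing v n := by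
  have hδ0' : (0 : ℝ) < δ := by exact_mod_cast hδ0
  have hδ1' : (δ : ℝ) < 1 := by exact_mod_cast hδ1
  have hb' : (2 : ℝ) ≤ b := by exact_mod_cast hb
  filter_upwards [(hL δ).eventually (gt_mem_nhds (show F δ < 3 / 4 by linarith)),
    eventually_gt_atTop 0] with n hn hn0
  have hn0' : (0 : ℝ) < n := Nat.cast_pos.2 hn0
  rw [div_lt_iff₀ hn0'] at hn
  set M := largest (spacings v n) with hMdef
  have hM : 0 < M := largest_spacings_pos hb hv n
  -- A child shorter than `y` has proportion below `δ`, since its parent was at least `M`. By the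
  -- averages these are at most `3n/4` intervals.
  set y := (δ : ℝ) / 2 * M with hydef
  have hy0 : 0 < y := by positivity
  have hy : y < M := by nlinarith
  have hsmall : (((spacings v n).filter fun l => l ≤ y).card : ℝ) ≤ 3 / 4 * n := by
    rw [card_filter_le_spacings hb hv hs n hy]
    refine le_trans ?_ hn.le
    push_cast
    refine Finset.sum_le_sum fun k hk => Nat.cast_le.2 ?_
    have hMk : M ≤ largest (spacings v k) :=
      largest_spacings_antitone hv hs (Finset.mem_range.1 hk).le
    exact card_le_splitCount (hM.trans_le hMk) (by nlinarith)
  have hlarge : (((spacings v n).filter fun l => ¬ l ≤ y).card : ℝ) * y ≤ 1 := by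
    have h1 := Multiset.card_nsmul_le_sum (s := (spacings v n).filter fun l => ¬ l ≤ y) (a := y)
      fun l hl => (not_le.1 (Multiset.mem_filter.1 hl).2).le
    rw [nsmul_eq_mul] at h1
    have h2 := congrArg Multiset.sum (Multiset.filter_add_not (fun l => l ≤ y) (spacings v n))
    rw [Multiset.sum_add, sum_spacings hb hv hs] at h2
    have h3 : 0 ≤ ((spacings v n).filter fun l => l ≤ y).sum :=
      Multiset.sum_nonneg fun l hl => (spacings_pos hb hv (Multiset.mem_of_mem_filter hl)).le
    linarith
  have hcard : (((spacings v n).filter fun l => l ≤ y).card : ℝ)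
      + ((spacings v n).filter fun l => ¬ l ≤ y).card = 1 + n * ((b : ℝ) - 1) := by
    rw [← card_spacings hb hv n, ← Nat.cast_add, ← Multiset.card_add, Multiset.filter_add_not]
  rw [meanSpacing_eq hb hv hs]
  have hN : (0 : ℝ) < 1 + n * ((b : ℝ) - 1) := by nlinarith
  rw [le_inv_comm₀ (by positivity) (by positivity), inv_div, le_div_iff₀ hδ0']
  -- At least a quarter of the `N_n` intervals are longer than `y`, because `n ≤ N_n`; their total
  -- length is at most `1`.
  have hq : (1 + n * ((b : ℝ) - 1)) / 4 * y ≤ 1 := by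
    refine le_trans (mul_le_mul_of_nonneg_right ?_ hy0.le) hlarge
    nlinarith
  rw [hydef] at hq
  nlinarith

/-- Writing `M_n = 1/(m_n N_n)`, the ratio is `(m_{⌊an⌋}/m_n)(N_{⌊an⌋}/N_n)`. The first factor tends
to `1` because `m > 0`, the second to `a`. -/
theorem tendsto_largest_ratio (hb : 2 ≤ b) (hv : ∀ n j, 0 < v n j) (hs : ∀ n, ∑ j, v n j = 1)
    {m : ℝ} (hm : 0 < m) (h : Tendsto (meanSpacing v) atTop (𝓝 m)) {a : ℝ} (ha : 0 < a) :
    Tendsto (fun n : ℕ => largest (spacings v n) / largest (spacings v ⌊a * n⌋₊)) atTop (𝓝 a) := by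
  have hb' : (2 : ℝ) ≤ b := by exact_mod_cast hb
  have hN : Tendsto (fun n : ℕ => (1 + (⌊a * n⌋₊ : ℝ) * ((b : ℝ) - 1)) / (1 + n * ((b : ℝ) - 1)))
      atTop (𝓝 a) := by
    have hinv : Tendsto (fun n : ℕ => (1 : ℝ) / n) atTop (𝓝 0) :=
      tendsto_one_div_atTop_nhds_zero_nat
    have h1 := (hinv.add ((tendsto_floor_mul_div ha.le).mul_const ((b : ℝ) - 1))).div
      (hinv.add_const ((b : ℝ) - 1)) (by linarith)
    rw [zero_add, zero_add, mul_div_cancel_right₀ _ (by linarith : (b : ℝ) - 1 ≠ 0)] at h1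
    refine h1.congr' ?_
    filter_upwards [eventually_gt_atTop 0] with n hn
    have hn' : (0 : ℝ) < n := Nat.cast_pos.2 hn
    have : (1 : ℝ) + n * (b - 1) ≠ 0 := by nlinarith
    simp only [Pi.div_apply]
    field_simp
  have h2 := ((h.comp (tendsto_floor_mul_atTop ha)).div h hm.ne').mul hN
  rw [div_self hm.ne', one_mul] at h2
  refine h2.congr fun n => ?_
  have hMn := largest_spacings_pos hb hv n
  have hMk := largest_spacings_pos hb hv ⌊a * n⌋₊
  have p1 : (0 : ℝ) < 1 + n * ((b : ℝ) - 1) := by nlinarith [(Nat.cast_nonneg n : (0 : ℝ) ≤ n)]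
  have p2 : (0 : ℝ) < 1 + (⌊a * n⌋₊ : ℝ) * ((b : ℝ) - 1) := by
    nlinarith [(Nat.cast_nonneg ⌊a * n⌋₊ : (0 : ℝ) ≤ ⌊a * n⌋₊)]
  simp only [Pi.div_apply, Function.comp_apply, meanSpacing_eq hb hv hs]
  field_simp

/-- The indices `k < n` are cut into `K` proportional blocks. Inside a block `M_n / M_k` is nearly
constant, so the counts are squeezed between `splitCount` at two rational thresholds, whose averages
are known. -/
theorem tendsto_card_filter_div (hb : 2 ≤ b) (hv : ∀ n j, 0 < v n j) (hs : ∀ n, ∑ j, v n j = 1)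
    (hF : Monotone F) (h0 : ∀ y, 0 ≤ F y) (hB : ∀ y, F y ≤ b)
    (hL : ∀ q : ℚ, Tendsto (fun n : ℕ => (∑ k ∈ Finset.range n, (splitCount (v k) q : ℝ)) / n)
      atTop (𝓝 (F q)))
    {m : ℝ} (hm : 0 < m) (h : Tendsto (meanSpacing v) atTop (𝓝 m)) {x : ℝ} (hx0 : 0 < x)
    (hx1 : x < 1) :
    Tendsto (fun n : ℕ =>
      (((spacings v n).filter fun l => l ≤ x * largest (spacings v n)).card : ℝ) / n) atTop
      (𝓝 (x⁻¹ * ∫ s in (0 : ℝ)..x, F s)) := by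
  have hM := largest_spacings_pos hb hv
  have hanti := largest_spacings_antitone hv hs
  set M : ℕ → ℝ := fun n => largest (spacings v n) with hMdef
  set A : ℕ → ℕ → ℝ := fun n k => ((Finset.univ.filter fun j => M k * v k j ≤ x * M n).card : ℝ)
    with hA
  have hcount : ∀ n, (((spacings v n).filter fun l => l ≤ x * largest (spacings v n)).card : ℝ)
      = ∑ k ∈ Finset.range n, A n k := by
    intro n
    rw [card_filter_le_spacings hb hv hs n (mul_lt_of_lt_one_left (hM n) hx1)]
    push_cast; rfl
  simp_rw [hcount]
  rw [Metric.tendsto_atTop']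
  intro ε hε
  -- This `K` makes the Riemann sum error `2b/K` smaller than `ε/2`.
  obtain ⟨K, hK⟩ := exists_nat_gt (2 * (2 * (b : ℝ) / ε))
  have hK0' : (0 : ℝ) < K := lt_of_le_of_lt (by positivity) hK
  have hK0 : 0 < K := Nat.cast_pos.1 hK0'
  have hKε : 2 * (b : ℝ) / K < ε / 2 := by
    rw [div_lt_iff₀ hK0']
    rw [← mul_div_assoc, div_lt_iff₀ hε] at hK
    linarith
  obtain ⟨rU, rL⟩ := riemann_sum_bounds hF h0 hB hx0 hK0
  have hblock : ∀ n, ∑ k ∈ Finset.range n, A n k = ∑ i ∈ Finset.range K,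
      ∑ k ∈ Finset.Ico ⌊(i / K : ℝ) * n⌋₊ ⌊((i + 1 : ℕ) / K : ℝ) * n⌋₊, A n k := by
    intro n
    rw [← sum_range_eq_sum_blocks (A n) (floor_blocks_monotone K n) (by simp) K]
    simp [div_self hK0'.ne']
  have hxK : 0 < x / K := by positivity
  -- At the right end of block `i` the ratio `x M_n / M_k` tends to `(i + 1) x / K`; the threshold
  -- lies strictly above this limit.
  have hqU : ∀ i : ℕ, ∃ q : ℚ, (i + 1) * (x / K) < (q : ℝ) ∧ (q : ℝ) < (i + 2) * (x / K) :=
    fun i => exists_rat_btwn (by nlinarith)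
  choose qU hqU1 hqU2 using hqU
  -- The first block starts at index `0`, where the ratio limit is not available; the threshold `0`
  -- makes the lower bound trivial there.
  have hqL : ∀ i : ℕ, ∃ q : ℚ, (i - 1) * (x / K) ≤ (q : ℝ) ∧
      ((q : ℝ) ≤ 0 ∨ (0 < i ∧ (q : ℝ) < i * (x / K))) := by
    intro i
    rcases Nat.eq_zero_or_pos i with rfl | hi
    · refine ⟨0, ?_, Or.inl (by simp)⟩
      push_cast; nlinarith
    · obtain ⟨q, h1, h2⟩ := exists_rat_btwn
        (show ((i : ℝ) - 1) * (x / K) < i * (x / K) by nlinarith)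
      exact ⟨q, h1.le, Or.inr ⟨hi, h2⟩⟩
  choose qL hqL1 hqL2 using hqL
  have evU : ∀ᶠ n : ℕ in atTop, ∀ i ∈ Finset.range K,
      x * M n < qU i * M ⌊((i + 1 : ℕ) / K : ℝ) * n⌋₊ := by
    rw [eventually_all_finset]
    intro i _
    have h1 := (tendsto_largest_ratio hb hv hs hm h
      (show (0 : ℝ) < (i + 1 : ℕ) / K by positivity)).const_mul x
    have h2 : x * ((i + 1 : ℕ) / K : ℝ) < qU i := by
      refine lt_of_eq_of_lt ?_ (hqU1 i); push_cast; ring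
    filter_upwards [h1.eventually (gt_mem_nhds h2)] with n hn
    rwa [← mul_div_assoc, div_lt_iff₀ (hM _)] at hn
  have evL : ∀ᶠ n : ℕ in atTop, ∀ i ∈ Finset.range K, qL i * M ⌊(i / K : ℝ) * n⌋₊ ≤ x * M n := by
    rw [eventually_all_finset]
    intro i _
    rcases hqL2 i with hq | ⟨hi, hq⟩
    · exact Eventually.of_forall fun n =>
        (mul_nonpos_of_nonpos_of_nonneg hq (hM _).le).trans (mul_nonneg hx0.le (hM n).le)
    · have h1 := (tendsto_largest_ratio hb hv hs hm h
        (show (0 : ℝ) < i / K by positivity)).const_mul x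
      have h2 : (qL i : ℝ) < x * (i / K : ℝ) := by
        refine lt_of_lt_of_eq hq ?_; ring
      filter_upwards [h1.eventually (lt_mem_nhds h2)] with n hn
      rw [← mul_div_assoc, lt_div_iff₀ (hM _)] at hn
      exact hn.le
  have limU := tendsto_block_sum_div hL qU (K := K)
  have limL := tendsto_block_sum_div hL qL (K := K)
  have sU : (∑ i ∈ Finset.range K, F (qU i)) / K < x⁻¹ * (∫ s in (0 : ℝ)..x, F s) + ε := by
    have : (∑ i ∈ Finset.range K, F (qU i)) / K
        ≤ (∑ i ∈ Finset.range K, F ((i + 2) * (x / K))) / K := by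
      gcongr with i _; exact hF (hqU2 i).le
    linarith
  have sL : x⁻¹ * (∫ s in (0 : ℝ)..x, F s) - ε < (∑ i ∈ Finset.range K, F (qL i)) / K := by
    have : (∑ i ∈ Finset.range K, F ((i - 1) * (x / K))) / K
        ≤ (∑ i ∈ Finset.range K, F (qL i)) / K := by
      gcongr with i _; exact hF (hqL1 i)
    linarith
  have fin : ∀ᶠ n : ℕ in atTop, dist ((∑ k ∈ Finset.range n, A n k) / n)
      (x⁻¹ * ∫ s in (0 : ℝ)..x, F s) < ε := by
    filter_upwards [evU, evL, limU.eventually (gt_mem_nhds sU), limL.eventually (lt_mem_nhds sL)]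
      with n hU hLn lU lL
    rw [Real.dist_eq, abs_sub_lt_iff]
    constructor
    · rw [sub_lt_iff_lt_add']
      refine lt_of_le_of_lt ?_ lU
      rw [hblock n]
      gcongr with i hi k hk
      -- `M` is antitone, so the inequality at the right end of the block holds throughout it.
      refine Nat.cast_le.2 (card_le_splitCount (hM k) ((hU i hi).trans_le ?_))
      have hq0 : (0 : ℝ) ≤ qU i := le_trans (by positivity) (hqU1 i).le
      exact mul_le_mul_of_nonneg_left (hanti (Finset.mem_Ico.1 hk).2.le) hq0
    · rw [sub_lt_comm]
      refine lt_of_lt_of_le lL ?_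
      rw [hblock n]
      gcongr with i hi k hk
      refine Nat.cast_le.2 (splitCount_le_card (hM k) ?_)
      rcases le_total (qL i : ℝ) 0 with hq | hq
      · exact (mul_nonpos_of_nonpos_of_nonneg hq (hM _).le).trans (mul_nonneg hx0.le (hM n).le)
      · exact (mul_le_mul_of_nonneg_left (hanti (Finset.mem_Ico.1 hk).1) hq).trans (hLn i hi)
  obtain ⟨N, hN⟩ := eventually_atTop.1 fin
  exact ⟨N, fun n hn => hN n hn.le⟩

theorem tendsto_empiricalCDF (hb : 2 ≤ b) (hv : ∀ n j, 0 < v n j) (hs : ∀ n, ∑ j, v n j = 1)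
    (hF : Monotone F) (h0 : ∀ y, 0 ≤ F y) (hB : ∀ y, F y ≤ b)
    (hL : ∀ q : ℚ, Tendsto (fun n : ℕ => (∑ k ∈ Finset.range n, (splitCount (v k) q : ℝ)) / n)
      atTop (𝓝 (F q)))
    {δ : ℚ} (hδ0 : 0 < δ) (hδ1 : δ < 1) (hFδ : F δ ≤ 1 / 2)
    (h : MeanSpacingStationary v) {x : ℝ} (hx0 : 0 < x) (hx1 : x < 1) :
    Tendsto (fun n : ℕ => empiricalCDF v n x) atTop
      (𝓝 (((b : ℝ) - 1)⁻¹ * (x⁻¹ * ∫ s in (0 : ℝ)..x, F s))) := by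
  obtain ⟨m, hm⟩ := h
  have hb' : (2 : ℝ) ≤ b := by exact_mod_cast hb
  have hδ : (0 : ℝ) < δ := by exact_mod_cast hδ0
  have hm0 : 0 < m := lt_of_lt_of_le (by positivity)
    (ge_of_tendsto hm (meanSpacing_eventually_ge hb hv hs hL hδ0 hδ1 hFδ))
  have h1 := tendsto_card_filter_div hb hv hs hF h0 hB hL hm0 hm hx0 hx1
  have h2 : Tendsto (fun n : ℕ => ((1 : ℝ) / n + ((b : ℝ) - 1))⁻¹) atTop (𝓝 ((b : ℝ) - 1)⁻¹) := by
    have := (tendsto_one_div_atTop_nhds_zero_nat (𝕜 := ℝ)).add_const ((b : ℝ) - 1)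
    rw [zero_add] at this
    exact this.inv₀ (by linarith)
  refine (h2.mul h1).congr' ?_
  filter_upwards [eventually_gt_atTop 0] with n hn
  have hn' : (0 : ℝ) < n := Nat.cast_pos.2 hn
  rw [empiricalCDF, card_spacings hb hv]
  have : (1 : ℝ) + n * (b - 1) ≠ 0 := by nlinarith
  field_simp

end

/-! ### The function `F`, the moments of the splitting law and the constant `C` -/

section

/-! ### The expected count function -/

variable {b : ℕ} {ν : Measure (Fin b → ℝ)}

theorem splitCount_eq_sum (v : Fin b → ℝ) (x : ℝ) :
    (splitCount v x : ℝ) = ∑ j, if v j < x then (1 : ℝ) else 0 := by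
  rw [splitCount, Finset.card_filter]
  push_cast; rfl

theorem splitCount_le (v : Fin b → ℝ) (x : ℝ) : (splitCount v x : ℝ) ≤ b := by
  have h := Finset.card_le_univ (Finset.univ.filter fun j => v j < x)
  rw [Fintype.card_fin] at h
  exact_mod_cast h

theorem splitCount_mono (v : Fin b → ℝ) : Monotone (splitCount v) := fun _ _ hxy =>
  Finset.card_le_card (Finset.monotone_filter_right _ fun _ _ h => lt_of_lt_of_le h hxy)

theorem measurable_splitCount_uncurry :
    Measurable fun p : (Fin b → ℝ) × ℝ => (splitCount p.1 p.2 : ℝ) := by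
  simp_rw [splitCount_eq_sum]
  refine Finset.measurable_sum _ fun j _ => ?_
  exact Measurable.ite (measurableSet_lt ((measurable_pi_apply j).comp measurable_fst)
    measurable_snd) measurable_const measurable_const

theorem measurable_splitCount (x : ℝ) : Measurable fun v : Fin b → ℝ => (splitCount v x : ℝ) := by
  simp_rw [splitCount_eq_sum]
  exact Finset.measurable_sum _ fun j _ => Measurable.ite
    (measurableSet_lt (measurable_pi_apply j) measurable_const) measurable_const measurable_const

theorem integrable_splitCount [IsProbabilityMeasure ν] (x : ℝ) :
    Integrable (fun v : Fin b → ℝ => (splitCount v x : ℝ)) ν :=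
  Integrable.of_bound (measurable_splitCount x).aestronglyMeasurable b
    (ae_of_all _ fun v => by
      rw [Real.norm_of_nonneg (Nat.cast_nonneg _)]; exact splitCount_le v x)

theorem expectedCount_nonneg (x : ℝ) : 0 ≤ expectedCount ν x :=
  integral_nonneg fun _ => Nat.cast_nonneg _

theorem expectedCount_le [IsProbabilityMeasure ν] (x : ℝ) : expectedCount ν x ≤ b := by
  have h := integral_mono (integrable_splitCount (ν := ν) x) (integrable_const (b : ℝ))
    fun v => splitCount_le v x
  simpa [expectedCount] using h

theorem expectedCount_mono [IsProbabilityMeasure ν] : Monotone (expectedCount ν) := fun x y hxy =>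
  integral_mono (integrable_splitCount x) (integrable_splitCount y) fun v =>
    Nat.cast_le.2 (splitCount_mono v hxy)

/-- Dominated convergence with bound `b`. It gives `F(0+) = 0` with `c = 0`, and left continuity at
`1` with `c = b`. -/
theorem tendsto_expectedCount [IsProbabilityMeasure ν] {l : Filter ℝ} [l.IsCountablyGenerated]
    {c : ℕ} (h : ∀ᵐ v ∂ν, ∀ᶠ x in l, splitCount v x = c) :
    Tendsto (expectedCount ν) l (𝓝 (c : ℝ)) := by
  have h1 : ∫ _ : Fin b → ℝ, (c : ℝ) ∂ν = c := by simp
  rw [← h1]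
  refine tendsto_integral_filter_of_dominated_convergence (fun _ => (b : ℝ))
    (Eventually.of_forall fun x => (measurable_splitCount x).aestronglyMeasurable)
    (Eventually.of_forall fun x => ae_of_all _ fun v => ?_) (integrable_const _) ?_
  · rw [Real.norm_of_nonneg (Nat.cast_nonneg _)]; exact splitCount_le v x
  · filter_upwards [h] with v hv
    refine tendsto_const_nhds.congr' ?_
    filter_upwards [hv] with x hx
    rw [hx]

theorem IsSplittingLaw.tendsto_expectedCount_zero (hν : IsSplittingLaw ν) :
    Tendsto (expectedCount ν) (𝓝[>] 0) (𝓝 0) := by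
  have := hν.prob
  suffices h : Tendsto (expectedCount ν) (𝓝[>] 0) (𝓝 ((0 : ℕ) : ℝ)) by simpa using h
  refine tendsto_expectedCount ?_
  filter_upwards [hν.pos] with v hv
  have : ∀ᶠ x in 𝓝[>] (0 : ℝ), ∀ j, x < v j :=
    eventually_all.2 fun j => nhdsWithin_le_nhds (gt_mem_nhds (hv j))
  filter_upwards [this] with x hx
  rw [splitCount, Finset.card_eq_zero, Finset.filter_eq_empty_iff]
  exact fun j _ => not_lt.2 (hx j).le

theorem IsSplittingLaw.ae_lt_one (hb : 2 ≤ b) (hν : IsSplittingLaw ν) :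
    ∀ᵐ v ∂ν, ∀ j, v j < 1 := by
  filter_upwards [hν.pos, hν.sum_eq_one] with v hv hs j
  have : Nontrivial (Fin b) := Fin.nontrivial_iff_two_le.2 hb
  obtain ⟨i, hi⟩ := exists_ne j
  have h := Finset.add_le_sum (f := v) (fun k _ => (hv k).le) (Finset.mem_univ i)
    (Finset.mem_univ j) hi
  linarith [hv i]

theorem splitCount_eq_of_forall_lt {v : Fin b → ℝ} {x : ℝ} (h : ∀ j, v j < x) :
    splitCount v x = b := by
  rw [splitCount, Finset.filter_true_of_mem fun j _ => h j, Finset.card_univ, Fintype.card_fin]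

theorem IsSplittingLaw.tendsto_expectedCount_one (hb : 2 ≤ b) (hν : IsSplittingLaw ν) :
    Tendsto (expectedCount ν) (𝓝[≤] 1) (𝓝 (b : ℝ)) := by
  have := hν.prob
  refine tendsto_expectedCount ?_
  filter_upwards [hν.ae_lt_one hb] with v hv
  have : ∀ᶠ x in 𝓝[≤] (1 : ℝ), ∀ j, v j < x :=
    eventually_all.2 fun j => nhdsWithin_le_nhds (lt_mem_nhds (hv j))
  filter_upwards [this] with x hx
  exact splitCount_eq_of_forall_lt hx

theorem IsSplittingLaw.expectedCount_one (hb : 2 ≤ b) (hν : IsSplittingLaw ν) :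
    expectedCount ν 1 = b := by
  have := hν.prob
  have h : ∀ᵐ v ∂ν, (splitCount v 1 : ℝ) = b := by
    filter_upwards [hν.ae_lt_one hb] with v hv
    rw [splitCount_eq_of_forall_lt hv]
  rw [expectedCount, integral_congr_ae h]
  simp

/-! ### Moments of the splitting law -/

theorem integral_indicator_lt_rpow {a p : ℝ} (ha : 0 < a) (ha1 : a ≤ 1) (hp : 0 < p) :
    ∫ s in (0 : ℝ)..1, (if a < s then (1 : ℝ) else 0) * s ^ (p - 1) = (1 - a ^ p) / p := by
  have h1 : ∀ s : ℝ, (if a < s then (1 : ℝ) else 0) * s ^ (p - 1)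
      = (Ioi a).indicator (fun s => s ^ (p - 1)) s := by
    intro s
    by_cases h : a < s
    · rw [if_pos h, one_mul, indicator_of_mem (mem_Ioi.2 h)]
    · rw [if_neg h, zero_mul, indicator_of_notMem (by simpa using h)]
  simp_rw [h1]
  rw [intervalIntegral.integral_of_le zero_le_one, integral_indicator measurableSet_Ioi,
    Measure.restrict_restrict measurableSet_Ioi]
  have h2 : Ioi a ∩ Ioc 0 1 = Ioc a 1 := by
    ext x; simp only [mem_inter_iff, mem_Ioi, mem_Ioc]
    exact ⟨fun h => ⟨h.1, h.2.2⟩, fun h => ⟨h.1, ha.trans h.1, h.2⟩⟩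
  rw [h2, ← intervalIntegral.integral_of_le ha1, integral_rpow (Or.inl (by linarith))]
  simp

theorem intervalIntegrable_indicator_lt_rpow (a : ℝ) {p : ℝ} (hp : 0 < p) :
    IntervalIntegrable (fun s : ℝ => (if a < s then (1 : ℝ) else 0) * s ^ (p - 1)) volume 0 1 := by
  have h := intervalIntegral.intervalIntegrable_rpow' (a := 0) (b := 1) (r := p - 1) (by linarith)
  refine h.mono_fun ?_ (ae_of_all _ fun s => ?_)
  · exact ((Measurable.ite measurableSet_Ioi measurable_const measurable_const).mul
      (by fun_prop)).aestronglyMeasurable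
  · dsimp only
    rw [norm_mul]
    refine mul_le_of_le_one_left (norm_nonneg _) ?_
    split_ifs <;> simp

theorem integral_splitCount_rpow {v : Fin b → ℝ} (hv : ∀ j, 0 < v j) (hv1 : ∀ j, v j ≤ 1) {p : ℝ}
    (hp : 0 < p) :
    ∫ s in (0 : ℝ)..1, (splitCount v s : ℝ) * s ^ (p - 1) = (b - ∑ j, v j ^ p) / p := by
  simp_rw [splitCount_eq_sum, Finset.sum_mul]
  rw [intervalIntegral.integral_finsetSum fun j _ => intervalIntegrable_indicator_lt_rpow (v j) hp]
  simp_rw [integral_indicator_lt_rpow (hv _) (hv1 _) hp]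
  rw [← Finset.sum_div, Finset.sum_sub_distrib]
  simp

theorem IsSplittingLaw.integrable_sum_rpow (hb : 2 ≤ b) (hν : IsSplittingLaw ν) {p : ℝ}
    (hp : 0 ≤ p) : Integrable (fun v : Fin b → ℝ => ∑ j, v j ^ p) ν := by
  have := hν.prob
  refine Integrable.of_bound (Measurable.aestronglyMeasurable (by fun_prop)) b ?_
  filter_upwards [hν.pos, hν.ae_lt_one hb] with v hv hv1
  rw [Real.norm_of_nonneg (Finset.sum_nonneg fun j _ => Real.rpow_nonneg (hv j).le _)]
  refine (Finset.sum_le_sum fun j _ => Real.rpow_le_one (hv j).le (hv1 j).le hp).trans ?_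
  simp

/-- By Fubini, each spacing contributes the integral of `s ^ (p - 1)` over `(V_j, 1]`. The
normalization of `u_C` thus becomes an equation between moments. -/
theorem IsSplittingLaw.integral_expectedCount_rpow (hb : 2 ≤ b) (hν : IsSplittingLaw ν) {p : ℝ}
    (hp : 0 < p) :
    ∫ s in (0 : ℝ)..1, expectedCount ν s * s ^ (p - 1) = (b - ∫ v, ∑ j, v j ^ p ∂ν) / p := by
  have := hν.prob
  have h1 : ∀ s : ℝ, expectedCount ν s * s ^ (p - 1)
      = ∫ v, (splitCount v s : ℝ) * s ^ (p - 1) ∂ν := fun s => (integral_mul_const _ _).symm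
  simp_rw [h1]
  have hi : Integrable (Function.uncurry fun (s : ℝ) (v : Fin b → ℝ) =>
      (splitCount v s : ℝ) * s ^ (p - 1)) ((volume.restrict (uIoc 0 1)).prod ν) := by
    have h := intervalIntegral.intervalIntegrable_rpow' (a := 0) (b := 1) (r := p - 1) (by linarith)
    have h2 := ((intervalIntegrable_iff.1 h).comp_fst ν).norm.const_mul (b : ℝ)
    refine h2.mono' ?_ (ae_of_all _ fun z => ?_)
    · exact ((measurable_splitCount_uncurry.comp measurable_swap).mul
        (by fun_prop : Measurable fun z : ℝ × (Fin b → ℝ) => z.1 ^ (p - 1))).aestronglyMeasurable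
    · simp only [Function.uncurry]
      rw [norm_mul, Real.norm_of_nonneg (Nat.cast_nonneg _)]
      exact mul_le_mul_of_nonneg_right (splitCount_le _ _) (norm_nonneg _)
  rw [intervalIntegral_integral_swap hi]
  have h3 : ∀ᵐ v ∂ν, ∫ s in (0 : ℝ)..1, (splitCount v s : ℝ) * s ^ (p - 1)
      = (b - ∑ j, v j ^ p) / p := by
    filter_upwards [hν.pos, hν.ae_lt_one hb] with v hv hv1
    exact integral_splitCount_rpow hv (fun j => (hv1 j).le) hp
  rw [integral_congr_ae h3, integral_div, integral_sub (integrable_const _)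
    (hν.integrable_sum_rpow hb hp.le)]
  simp

theorem IsSplittingLaw.integral_sum_rpow_one (hν : IsSplittingLaw ν) :
    ∫ v, ∑ j, v j ^ (1 : ℝ) ∂ν = 1 := by
  have := hν.prob
  have h : ∀ᵐ v ∂ν, ∑ j, v j ^ (1 : ℝ) = 1 := by
    filter_upwards [hν.sum_eq_one] with v hv
    simpa using hv
  rw [integral_congr_ae h]
  simp

/-- Powers of `V_j ∈ (0, 1)` strictly decrease in the exponent, and an almost surely positive
difference has positive integral. -/
theorem IsSplittingLaw.integral_sum_rpow_lt (hb : 2 ≤ b) (hν : IsSplittingLaw ν) {p q : ℝ}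
    (hp : 0 ≤ p) (hpq : p < q) : ∫ v, ∑ j, v j ^ q ∂ν < ∫ v, ∑ j, v j ^ p ∂ν := by
  have := hν.prob
  have : Nonempty (Fin b) := ⟨⟨0, by omega⟩⟩
  have hlt : ∀ᵐ v ∂ν, 0 < ∑ j, v j ^ p - ∑ j, v j ^ q := by
    filter_upwards [hν.pos, hν.ae_lt_one hb] with v hv hv1
    exact sub_pos.2 (Finset.sum_lt_sum_of_nonempty Finset.univ_nonempty fun j _ =>
      Real.rpow_lt_rpow_of_exponent_gt (hv j) (hv1 j) hpq)
  have hip := hν.integrable_sum_rpow hb hp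
  have hiq := hν.integrable_sum_rpow hb (hp.trans hpq.le)
  rw [← sub_pos, ← integral_sub hip hiq,
    integral_pos_iff_support_of_nonneg_ae (hlt.mono fun _ h => h.le) (hip.sub hiq)]
  have : ν (Function.support fun v : Fin b → ℝ => ∑ j, v j ^ p - ∑ j, v j ^ q) = 1 := by
    rw [← measure_univ (μ := ν)]
    exact measure_congr (eventuallyEq_univ.2 (hlt.mono fun _ h => h.ne'))
  rw [this]
  exact one_pos

/-- `C = 1 / (b - 1)` is the only solution of the normalization `u_C(1) = 1`. -/
theorem IsSplittingLaw.normalization_iff (hb : 2 ≤ b) (hν : IsSplittingLaw ν) (C : ℝ) :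
    (0 < C ∧ stationaryCDF b (expectedCount ν) C 1 = 1) ↔ C = ((b : ℝ) - 1)⁻¹ := by
  have hb' : (2 : ℝ) ≤ b := by exact_mod_cast hb
  have hb1 : (0 : ℝ) < (b : ℝ) - 1 := by linarith
  have key : ∀ C : ℝ, 0 < C → (stationaryCDF b (expectedCount ν) C 1 = 1 ↔
      ∫ v, ∑ j, v j ^ (C * ((b : ℝ) - 1)) ∂ν = 1) := by
    intro C hC
    rw [stationaryCDF, Real.one_rpow, mul_one,
      hν.integral_expectedCount_rpow hb (mul_pos hC hb1)]
    field_simp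
    constructor <;> intro h <;> linarith
  constructor
  · rintro ⟨hC, h⟩
    replace h := ((key C hC).1 h).trans hν.integral_sum_rpow_one.symm
    rcases lt_trichotomy (C * ((b : ℝ) - 1)) 1 with hlt | heq | hgt
    · exact absurd h (hν.integral_sum_rpow_lt hb (mul_pos hC hb1).le hlt).ne'
    · exact eq_inv_of_mul_eq_one_left heq
    · exact absurd h (hν.integral_sum_rpow_lt hb zero_le_one hgt).ne
  · rintro rfl
    refine ⟨inv_pos.2 hb1, (key _ (inv_pos.2 hb1)).2 ?_⟩
    rw [inv_mul_cancel₀ hb1.ne', hν.integral_sum_rpow_one]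

theorem IsSplittingLaw.integral_expectedCount (hb : 2 ≤ b) (hν : IsSplittingLaw ν) :
    ∫ s in (0 : ℝ)..1, expectedCount ν s = (b : ℝ) - 1 := by
  have h := hν.integral_expectedCount_rpow hb one_pos
  simpa [hν.integral_sum_rpow_one, -Real.rpow_one] using h

theorem stationaryCDF_inv_eq (hb : 2 ≤ b) (F : ℝ → ℝ) (x : ℝ) :
    stationaryCDF b F ((b : ℝ) - 1)⁻¹ x = ((b : ℝ) - 1)⁻¹ * (x⁻¹ * ∫ s in (0 : ℝ)..x, F s) := by
  have hb' : (2 : ℝ) ≤ b := by exact_mod_cast hb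
  have hb1 : (b : ℝ) - 1 ≠ 0 := by linarith
  rw [stationaryCDF, inv_mul_cancel₀ hb1]
  simp [Real.rpow_neg_one, mul_assoc]

/-- The derivative of `x⁻¹ ∫₀ˣ F` at `1` is `F(1) - ∫₀¹ F = b - (b - 1) = 1`; the one-sided
fundamental theorem needs `F` left continuous at `1`. -/
theorem IsSplittingLaw.hasDerivWithinAt_stationaryCDF (hb : 2 ≤ b) (hν : IsSplittingLaw ν) :
    HasDerivWithinAt (stationaryCDF b (expectedCount ν) ((b : ℝ) - 1)⁻¹) ((b : ℝ) - 1)⁻¹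
      (Iic 1) 1 := by
  have := hν.prob
  have hb' : (2 : ℝ) ≤ b := by exact_mod_cast hb
  have hb1 : (b : ℝ) - 1 ≠ 0 := by linarith
  rw [funext (stationaryCDF_inv_eq hb (expectedCount ν))]
  have hc : ContinuousWithinAt (expectedCount ν) (Iic 1) 1 := by
    rw [ContinuousWithinAt, hν.expectedCount_one hb]
    exact hν.tendsto_expectedCount_one hb
  have hFTC := intervalIntegral.integral_hasDerivWithinAt_right
    (expectedCount_mono (ν := ν)).intervalIntegrable (a := 0) (b := 1) (s := Iic 1) (t := Iic 1)
    ((expectedCount_mono (ν := ν)).measurable.stronglyMeasurable.stronglyMeasurableAtFilter) hc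
  have h := ((hasDerivAt_inv (one_ne_zero (α := ℝ))).hasDerivWithinAt (s := Iic 1)).mul hFTC
  have h' := h.const_mul ((b : ℝ) - 1)⁻¹
  refine h'.congr_deriv ?_
  rw [hν.integral_expectedCount hb, hν.expectedCount_one hb]
  field_simp
  ring

end

section

/-! ### The random fragmentation -/

variable {b : ℕ} {ν : Measure (Fin b → ℝ)}

/-- The strong law is applied at rational thresholds only, so that countably many null sets are
discarded. Off that set the convergence argument is deterministic. -/
theorem ae_tendsto_average_splitCount (hν : IsSplittingLaw ν)
    {Ω : Type*} [MeasurableSpace Ω] (P : Measure Ω) [IsProbabilityMeasure P]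
    (V : ℕ → Ω → Fin b → ℝ) (hV : ∀ n, Measurable (V n)) (hlaw : ∀ n, P.map (V n) = ν)
    (hind : iIndepFun V P) :
    ∀ᵐ ω ∂P, ∀ q : ℚ,
      Tendsto (fun n : ℕ => (∑ k ∈ Finset.range n, (splitCount (V k ω) q : ℝ)) / n) atTop
        (𝓝 (expectedCount ν q)) := by
  have := hν.prob
  rw [ae_all_iff]
  intro q
  have hmeas := measurable_splitCount (b := b) (q : ℝ)
  have hident : ∀ i, IdentDistrib (V i) (V 0) P P := fun i =>
    ⟨(hV i).aemeasurable, (hV 0).aemeasurable, by rw [hlaw, hlaw]⟩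
  have hexp : ∫ ω, (splitCount (V 0 ω) q : ℝ) ∂P = expectedCount ν q := by
    rw [expectedCount, ← hlaw 0, integral_map (hV 0).aemeasurable hmeas.aestronglyMeasurable]
  rw [← hexp]
  refine strong_law_ae_real (fun i ω => (splitCount (V i ω) q : ℝ)) ?_ ?_ ?_
  · refine Integrable.of_bound (hmeas.comp (hV 0)).aestronglyMeasurable b (ae_of_all _ fun ω => ?_)
    rw [Real.norm_of_nonneg (Nat.cast_nonneg _)]
    exact splitCount_le _ _
  · exact fun i j hij => (hind.indepFun hij).comp hmeas hmeas
  · exact fun i => (hident i).comp hmeas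

theorem ae_stationary_iff (hb : 2 ≤ b) (hν : IsSplittingLaw ν)
    {Ω : Type*} [MeasurableSpace Ω] (P : Measure Ω) [IsProbabilityMeasure P]
    (V : ℕ → Ω → Fin b → ℝ) (hV : ∀ n, Measurable (V n)) (hlaw : ∀ n, P.map (V n) = ν)
    (hind : iIndepFun V P) :
    ∀ᵐ ω ∂P,
      (SpacingDistributionStationary (fun n => V n ω) ↔ MeanSpacingStationary (fun n => V n ω)) ∧
      ∀ u : ℝ → ℝ, IsLimitingCDF (fun n => V n ω) u → ∀ x ∈ Ioc (0 : ℝ) 1,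
        u x = stationaryCDF b (expectedCount ν) ((b : ℝ) - 1)⁻¹ x := by
  have := hν.prob
  have hpos : ∀ᵐ ω ∂P, ∀ n, ∀ j, 0 < V n ω j := by
    rw [ae_all_iff]
    intro n
    exact ae_of_ae_map (hV n).aemeasurable (by rw [hlaw n]; exact hν.pos)
  have hsum : ∀ᵐ ω ∂P, ∀ n, ∑ j, V n ω j = 1 := by
    rw [ae_all_iff]
    intro n
    exact ae_of_ae_map (hV n).aemeasurable (by rw [hlaw n]; exact hν.sum_eq_one)
  obtain ⟨δ, hδ0, hδ1, hFδ⟩ : ∃ δ : ℚ, 0 < δ ∧ δ < 1 ∧ expectedCount ν δ ≤ 1 / 2 := by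
    have h1 := hν.tendsto_expectedCount_zero.eventually
      (gt_mem_nhds (show (0 : ℝ) < 1 / 2 by norm_num))
    obtain ⟨c, hc, hc'⟩ := mem_nhdsGT_iff_exists_Ioo_subset.1 h1
    obtain ⟨δ, hδ0, hδ⟩ := exists_rat_btwn (show (0 : ℝ) < min c 1 from lt_min hc one_pos)
    exact ⟨δ, by exact_mod_cast hδ0, by exact_mod_cast hδ.trans_le (min_le_right _ _),
      (hc' ⟨hδ0, hδ.trans_le (min_le_left _ _)⟩).le⟩
  filter_upwards [hpos, hsum, ae_tendsto_average_splitCount hν P V hV hlaw hind] with ω hv hs hL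
  have hmean : SpacingDistributionStationary (fun n => V n ω) →
      MeanSpacingStationary (fun n => V n ω) :=
    meanSpacingStationary_of_spacingDistributionStationary hb hv
  have hlim : MeanSpacingStationary (fun n => V n ω) → IsLimitingCDF (fun n => V n ω)
      (stationaryCDF b (expectedCount ν) ((b : ℝ) - 1)⁻¹) := by
    intro h x hx
    -- At `x = 1` intervals of maximal length count as well, so the birth count does not apply; both
    -- sides are `1` there.
    rcases hx.2.eq_or_lt with rfl | hx1
    · rw [((hν.normalization_iff hb _).2 rfl).2]
      refine tendsto_const_nhds.congr fun n => ?_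
      rw [empiricalCDF_one hb hv]
    · rw [stationaryCDF_inv_eq hb]
      exact tendsto_empiricalCDF hb hv hs expectedCount_mono expectedCount_nonneg
        expectedCount_le hL hδ0 hδ1 hFδ h hx.1 hx1
  exact ⟨⟨hmean, fun h => ⟨_, hlim h⟩⟩, fun u hu x hx =>
    tendsto_nhds_unique (hu x hx) (hlim (hmean ⟨u, hu⟩) x hx)⟩

end

section

/-! ### The feedback equation -/

theorem eq_zero_of_forall_integral_eq_zero {r : ℝ → ℝ} (hr : ContinuousOn r (Ici 0))
    (h : ∀ s t : ℝ, 0 ≤ s → s ≤ t → ∫ τ in s..t, r τ = 0) {s : ℝ} (hs : 0 ≤ s) : r s = 0 := by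
  -- The constant extension to negative times is continuous on the whole line, so the fundamental
  -- theorem also applies at `s = 0`.
  set r' : ℝ → ℝ := fun t => r (max t 0) with hr'
  have hc : Continuous r' :=
    hr.comp_continuous (continuous_id.max continuous_const) fun t => mem_Ici.2 (le_max_right t 0)
  have h1 : HasDerivWithinAt (fun t => ∫ τ in s..t, r' τ) (r' s) (Ici s) s :=
    (intervalIntegral.integral_hasDerivAt_right (hc.intervalIntegrable s s)
      hc.stronglyMeasurable.stronglyMeasurableAtFilter hc.continuousAt).hasDerivWithinAt
  have h2 : HasDerivWithinAt (fun t => ∫ τ in s..t, r' τ) 0 (Ici s) s := by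
    refine (hasDerivWithinAt_const s (Ici s) (0 : ℝ)).congr_of_mem (fun t ht => ?_) self_mem_Ici
    rw [← h s t hs ht]
    refine intervalIntegral.integral_congr fun τ hτ => ?_
    rw [uIcc_of_le ht] at hτ
    simp only [hr', max_eq_left (hs.trans hτ.1)]
  have h3 := (uniqueDiffWithinAt_Ici s).eq_deriv _ h1 h2
  simpa only [hr', max_eq_left hs] using h3

namespace IsFeedbackSolution

variable {b : ℕ} {F : ℝ → ℝ} {u ux ut : ℝ → ℝ → ℝ}

theorem nonneg (h : IsFeedbackSolution b F u ux ut) {t : ℝ} (ht : 0 ≤ t) {x : ℝ}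
    (hx : x ∈ Ioc (0 : ℝ) 1) : 0 ≤ u x t := by
  refine le_of_tendsto (h.at_zero t ht) ?_
  filter_upwards [Ioc_mem_nhdsGT hx.1] with y hy
  exact h.mono t ht ⟨hy.1, hy.2.trans hx.2⟩ hx hy.2

theorem le_one (h : IsFeedbackSolution b F u ux ut) {t : ℝ} (ht : 0 ≤ t) {x : ℝ}
    (hx : x ∈ Ioc (0 : ℝ) 1) : u x t ≤ 1 := by
  rw [← h.at_one t ht]
  exact h.mono t ht hx ⟨one_pos, le_rfl⟩ hx.2

theorem ux_nonneg (h : IsFeedbackSolution b F u ux ut) {t : ℝ} (ht : 0 ≤ t) {x : ℝ}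
    (hx : x ∈ Ioc (0 : ℝ) 1) : 0 ≤ ux x t := by
  rw [← (h.hasDeriv_x x hx t ht).derivWithin (uniqueDiffOn_Ioc 0 1 x hx)]
  exact (h.mono t ht).derivWithin_nonneg

theorem hasDerivAt_x (h : IsFeedbackSolution b F u ux ut) {t : ℝ} (ht : 0 ≤ t) {x : ℝ}
    (hx : x ∈ Ioo (0 : ℝ) 1) : HasDerivAt (fun y => u y t) (ux x t) x :=
  (h.hasDeriv_x x (Ioo_subset_Ioc_self hx) t ht).hasDerivAt (Ioc_mem_nhds hx.1 hx.2)

theorem hasDerivAt_t (h : IsFeedbackSolution b F u ux ut) {t : ℝ} (ht : 0 < t) {x : ℝ}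
    (hx : x ∈ Ioc (0 : ℝ) 1) : HasDerivAt (fun s => u x s) (ut x t) t :=
  (h.hasDeriv_t x hx t ht.le).hasDerivAt (Ici_mem_nhds ht)

theorem continuousOn_x (h : IsFeedbackSolution b F u ux ut) {t : ℝ} (ht : 0 ≤ t) :
    ContinuousOn (fun x => u x t) (Ioc 0 1) :=
  fun x hx => (h.hasDeriv_x x hx t ht).continuousWithinAt

theorem continuousOn_ux_one (h : IsFeedbackSolution b F u ux ut) :
    ContinuousOn (fun t => ux 1 t) (Ici 0) :=
  h.cont_x.comp (f := fun t : ℝ => ((1 : ℝ), t)) (by fun_prop)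
    fun _ ht => ⟨⟨one_pos, le_rfl⟩, ht⟩

theorem intervalIntegrable_u (h : IsFeedbackSolution b F u ux ut) {t : ℝ} (ht : 0 ≤ t) {x y : ℝ}
    (hx : x ∈ Icc (0 : ℝ) 1) (hy : y ∈ Icc (0 : ℝ) 1) :
    IntervalIntegrable (fun x => u x t) volume x y := by
  have h1 : IntegrableOn (fun x => u x t) (Ioc 0 1) := by
    refine IntegrableOn.of_bound (C := 1) (by simp)
      ((h.continuousOn_x ht).aestronglyMeasurable measurableSet_Ioc) ?_
    filter_upwards [ae_restrict_mem measurableSet_Ioc] with x hx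
    rw [Real.norm_of_nonneg (h.nonneg ht hx)]
    exact h.le_one ht hx
  rw [intervalIntegrable_iff]
  exact h1.mono_set (Ioc_subset_Ioc (le_min hx.1 hy.1) (max_le hx.2 hy.2))

/-- The value `u 0 t` is arbitrary; a weight vanishing at `0` makes the product continuous up to
`0`. The weights used are `x` and `x ^ p`. -/
theorem continuousOn_weight_mul (h : IsFeedbackSolution b F u ux ut) {t : ℝ} (ht : 0 ≤ t)
    {w : ℝ → ℝ} (hw : Continuous w) (hw0 : w 0 = 0) :
    ContinuousOn (fun x => w x * u x t) (Icc 0 1) := by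
  intro x hx
  rcases hx.1.eq_or_lt with rfl | hx0
  · have h1 : Tendsto (fun x => ‖w x‖) (𝓝[Icc 0 1] (0 : ℝ)) (𝓝 0) := by
      have := (hw.norm.tendsto 0).mono_left (nhdsWithin_le_nhds (s := Icc (0 : ℝ) 1))
      simpa [hw0] using this
    rw [ContinuousWithinAt, hw0, zero_mul]
    refine squeeze_zero_norm' ?_ h1
    filter_upwards [self_mem_nhdsWithin] with y hy
    rcases hy.1.eq_or_lt with rfl | hy0
    · simp [hw0]
    · rw [norm_mul, Real.norm_of_nonneg (h.nonneg ht ⟨hy0, hy.2⟩)]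
      exact mul_le_of_le_one_right (norm_nonneg _) (h.le_one ht ⟨hy0, hy.2⟩)
  · refine hw.continuousWithinAt.mul ((h.continuousOn_x ht x ⟨hx0, hx.2⟩).mono_of_mem_nhdsWithin ?_)
    filter_upwards [self_mem_nhdsWithin, nhdsWithin_le_nhds (Ioi_mem_nhds hx0)] with y hy hy0
    exact ⟨hy0, hy.2⟩

/-- No bound on `ux` near `0` is available. But `x u` is continuous with nonnegative derivative `u +
x u_x`, which is therefore integrable. -/
theorem intervalIntegrable_mul_ux (h : IsFeedbackSolution b F u ux ut) {t : ℝ} (ht : 0 ≤ t) {ε : ℝ}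
    (hε : ε ∈ Icc (0 : ℝ) 1) : IntervalIntegrable (fun x => x * ux x t) volume ε 1 := by
  have hsub : Ioo ε 1 ⊆ Ioo 0 1 := Ioo_subset_Ioo_left hε.1
  have h1 : IntervalIntegrable (fun x => 1 * u x t + x * ux x t) volume ε 1 := by
    rw [intervalIntegrable_iff_integrableOn_Ioc_of_le hε.2]
    refine intervalIntegral.integrableOn_deriv_of_nonneg (g := fun x => x * u x t)
      ((h.continuousOn_weight_mul ht continuous_id rfl).mono (Icc_subset_Icc_left hε.1))
      (fun x hx => (hasDerivAt_id x).mul (h.hasDerivAt_x ht (hsub hx))) fun x hx => ?_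
    have hx' := Ioo_subset_Ioc_self (hsub hx)
    have := h.nonneg ht hx'
    have := mul_nonneg hx'.1.le (h.ux_nonneg ht hx')
    linarith
  have h2 := h1.sub (h.intervalIntegrable_u ht hε ⟨zero_le_one, le_rfl⟩)
  exact h2.congr fun x _ => by simp

theorem integral_mul_ux (h : IsFeedbackSolution b F u ux ut) {t : ℝ} (ht : 0 ≤ t) {ε : ℝ}
    (hε : ε ∈ Icc (0 : ℝ) 1) :
    ∫ x in ε..1, x * ux x t = 1 - ε * u ε t - ∫ x in ε..1, u x t := by
  have hi := h.intervalIntegrable_mul_ux ht hε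
  have hu := h.intervalIntegrable_u ht hε (y := 1) ⟨zero_le_one, le_rfl⟩
  have h1 := intervalIntegral.integral_eq_sub_of_hasDerivAt_of_le (f := fun x => x * u x t)
    (f' := fun x => 1 * u x t + x * ux x t) hε.2
    ((h.continuousOn_weight_mul ht continuous_id rfl).mono (Icc_subset_Icc_left hε.1))
    (fun x hx => (hasDerivAt_id x).mul
      (h.hasDerivAt_x ht (Ioo_subset_Ioo_left hε.1 hx)))
    (by simpa only [one_mul] using hu.add hi)
  simp only [one_mul, h.at_one t ht] at h1
  rw [intervalIntegral.integral_add hu hi] at h1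
  linarith

theorem mean_eq (h : IsFeedbackSolution b F u ux ut) {t : ℝ} (ht : 0 ≤ t) :
    ∫ x in (0 : ℝ)..1, x * ux x t = 1 - ∫ x in (0 : ℝ)..1, u x t := by
  rw [h.integral_mul_ux ht ⟨le_rfl, zero_le_one⟩, zero_mul, sub_zero]

theorem integral_u_nonneg (h : IsFeedbackSolution b F u ux ut) {t : ℝ} (ht : 0 ≤ t) {ε : ℝ}
    (hε : ε ∈ Icc (0 : ℝ) 1) : 0 ≤ ∫ x in (0 : ℝ)..ε, u x t := by
  rw [intervalIntegral.integral_of_le hε.1]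
  exact setIntegral_nonneg measurableSet_Ioc fun x hx => h.nonneg ht ⟨hx.1, hx.2.trans hε.2⟩

theorem integral_u_le (h : IsFeedbackSolution b F u ux ut) {t : ℝ} (ht : 0 ≤ t) {x y c : ℝ}
    (hx : x ∈ Icc (0 : ℝ) 1) (hy : y ∈ Icc (0 : ℝ) 1) (hxy : x ≤ y)
    (hc : ∀ z ∈ Ioo x y, u z t ≤ c) : ∫ z in x..y, u z t ≤ c * (y - x) := by
  have := intervalIntegral.integral_mono_on_of_le_Ioo hxy (h.intervalIntegrable_u ht hx hy)
    (intervalIntegrable_const (c := c)) hc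
  simpa [mul_comm] using this

/-- Since `u(0+) = 0`, `u ≤ 1/2` on some `(0, δ)`, which keeps `∫₀¹ u` below `1`. -/
theorem mean_pos (h : IsFeedbackSolution b F u ux ut) {t : ℝ} (ht : 0 ≤ t) :
    0 < ∫ x in (0 : ℝ)..1, x * ux x t := by
  rw [h.mean_eq ht]
  have h1 := (h.at_zero t ht).eventually (gt_mem_nhds (show (0 : ℝ) < 1 / 2 by norm_num))
  obtain ⟨δ, hδ, hδI⟩ := (h1.and (Ioo_mem_nhdsGT one_pos)).exists
  have i0 : (0 : ℝ) ∈ Icc (0 : ℝ) 1 := ⟨le_rfl, zero_le_one⟩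
  have i1 : (1 : ℝ) ∈ Icc (0 : ℝ) 1 := ⟨zero_le_one, le_rfl⟩
  have iδ : δ ∈ Icc (0 : ℝ) 1 := Ioo_subset_Icc_self hδI
  have h2 := h.integral_u_le ht (c := 1 / 2) i0 iδ hδI.1.le fun z hz =>
    (h.mono t ht ⟨hz.1, hz.2.le.trans hδI.2.le⟩ (Ioo_subset_Ioc_self hδI) hz.2.le).trans hδ.le
  have h3 := h.integral_u_le ht (c := 1) iδ i1 hδI.2.le fun z hz =>
    h.le_one ht ⟨hδI.1.trans hz.1, hz.2.le⟩
  have h4 := intervalIntegral.integral_add_adjacent_intervals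
    (h.intervalIntegrable_u ht i0 iδ) (h.intervalIntegrable_u ht iδ i1)
  linarith [hδI.1]

/-! #### A constant mean spacing forces `u_x(1, t) = 1 / (b - 1)` -/

theorem integral_ut (h : IsFeedbackSolution b F u ux ut) (hF : Monotone F) {t : ℝ} (ht : 0 ≤ t)
    {ε : ℝ} (hε : ε ∈ Ioo (0 : ℝ) 1) :
    ∫ x in ε..1, ut x t
      = ux 1 t * (-((b : ℝ) - 1) * (∫ x in ε..1, u x t) + ∫ x in ε..1, F x)
        - (1 - ε * u ε t - ∫ x in ε..1, u x t) := by
  have hε' := Ioo_subset_Icc_self hε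
  have hu := h.intervalIntegrable_u ht hε' (y := 1) ⟨zero_le_one, le_rfl⟩
  have hFi : IntervalIntegrable F volume ε 1 := hF.intervalIntegrable
  have h1 : ∫ x in ε..1, ut x t
      = ∫ x in ε..1, (ux 1 t * (-((b : ℝ) - 1) * u x t + F x) - x * ux x t) := by
    refine intervalIntegral.integral_congr fun x hx => ?_
    rw [uIcc_of_le hε.2.le] at hx
    have := h.equation x ⟨hε.1.trans_le hx.1, hx.2⟩ t ht
    linarith
  rw [h1, intervalIntegral.integral_sub (((hu.const_mul _).add hFi).const_mul _)
    (h.intervalIntegrable_mul_ux ht hε'), intervalIntegral.integral_const_mul,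
    intervalIntegral.integral_add (hu.const_mul _) hFi, intervalIntegral.integral_const_mul,
    h.integral_mul_ux ht hε']

theorem rectangle_subset {ε s t : ℝ} (hε : 0 < ε) (hs : 0 ≤ s) :
    Icc ε 1 ×ˢ Icc s t ⊆ Ioc (0 : ℝ) 1 ×ˢ Ici (0 : ℝ) :=
  prod_mono (fun _ hx => ⟨hε.trans_le hx.1, hx.2⟩) fun _ hx => hs.trans hx.1

theorem integrableOn_ut (h : IsFeedbackSolution b F u ux ut) {ε s t : ℝ} (hε : 0 < ε)
    (hs : 0 ≤ s) : IntegrableOn (fun p : ℝ × ℝ => ut p.1 p.2) (Icc ε 1 ×ˢ Icc s t) :=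
  (h.cont_t.mono (rectangle_subset hε hs)).integrableOn_compact (isCompact_Icc.prod isCompact_Icc)

theorem intervalIntegrable_integral_ut (h : IsFeedbackSolution b F u ux ut) {ε s t : ℝ}
    (hε : ε ∈ Ioo (0 : ℝ) 1) (hs : 0 ≤ s) (hst : s ≤ t) :
    IntervalIntegrable (fun τ => ∫ x in ε..1, ut x τ) volume s t := by
  rw [intervalIntegrable_iff_integrableOn_Ioc_of_le hst]
  simp_rw [intervalIntegral.integral_of_le hε.2.le]
  have h1 := (h.integrableOn_ut (t := t) hε.1 hs).mono_set
    (prod_mono (Ioc_subset_Icc_self (a := ε) (b := (1 : ℝ)))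
      (Ioc_subset_Icc_self (a := s) (b := t)))
  rw [IntegrableOn, Measure.volume_eq_prod, ← Measure.prod_restrict] at h1
  exact h1.integral_prod_right

theorem integral_integral_ut (h : IsFeedbackSolution b F u ux ut) {ε s t : ℝ}
    (hε : ε ∈ Ioo (0 : ℝ) 1) (hs : 0 ≤ s) (hst : s ≤ t) :
    ∫ τ in s..t, ∫ x in ε..1, ut x τ = (∫ x in ε..1, u x t) - ∫ x in ε..1, u x s := by
  have hε' := Ioo_subset_Icc_self hε
  have i1 : (1 : ℝ) ∈ Icc (0 : ℝ) 1 := ⟨zero_le_one, le_rfl⟩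
  rw [← intervalIntegral.integral_sub (h.intervalIntegrable_u (hs.trans hst) hε' i1)
    (h.intervalIntegrable_u hs hε' i1)]
  rw [← intervalIntegral_intervalIntegral_swap (F := ut)]
  · refine intervalIntegral.integral_congr fun x hx => ?_
    rw [uIcc_of_le hε.2.le] at hx
    have hx' : x ∈ Ioc (0 : ℝ) 1 := ⟨hε.1.trans_le hx.1, hx.2⟩
    refine intervalIntegral.integral_eq_sub_of_hasDerivAt_of_le hst
      (fun τ hτ => ((h.hasDeriv_t x hx' τ (hs.trans hτ.1)).continuousWithinAt).mono
        fun _ hz => hs.trans hz.1)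
      (fun τ hτ => h.hasDerivAt_t (hs.trans_lt hτ.1) hx') ?_
    refine ContinuousOn.intervalIntegrable ?_
    rw [uIcc_of_le hst]
    exact h.cont_t.comp (f := fun τ : ℝ => (x, τ)) (by fun_prop) fun τ hτ => ⟨hx', hs.trans hτ.1⟩
  · rw [uIoc_of_le hε.2.le, uIoc_of_le hst]
    exact (h.integrableOn_ut (t := t) hε.1 hs).mono_set
      (prod_mono Ioc_subset_Icc_self Ioc_subset_Icc_self)

/-- At `ε = 0` the right side of `integral_ut` is exactly `m (g(b-1) - 1)`, by `∫ u = 1 - m` and `∫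
F = b - 1`. The cutoff is there because `ut` is controlled only for `x > 0`; it costs `O(ε)` because
`u ≤ 1` and `F ≤ b`. -/
theorem abs_integral_ut_sub_le (h : IsFeedbackSolution b F u ux ut) (hb : 2 ≤ b) (hF : Monotone F)
    (hF0 : ∀ x, 0 ≤ F x) (hFb : ∀ x, F x ≤ b) (hFint : ∫ x in (0 : ℝ)..1, F x = (b : ℝ) - 1)
    {t m : ℝ} (ht : 0 ≤ t) (hm : ∫ x in (0 : ℝ)..1, x * ux x t = m) {ε : ℝ}
    (hε : ε ∈ Ioo (0 : ℝ) 1) :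
    |(∫ x in ε..1, ut x t) - m * (ux 1 t * ((b : ℝ) - 1) - 1)| ≤ (ux 1 t * (2 * b) + 2) * ε := by
  have hb' : (2 : ℝ) ≤ b := by exact_mod_cast hb
  have hε' := Ioo_subset_Icc_self hε
  have i0 : (0 : ℝ) ∈ Icc (0 : ℝ) 1 := ⟨le_rfl, zero_le_one⟩
  have i1 : (1 : ℝ) ∈ Icc (0 : ℝ) 1 := ⟨zero_le_one, le_rfl⟩
  have hg := h.ux_nonneg ht ⟨one_pos, le_rfl⟩
  have hJ := intervalIntegral.integral_add_adjacent_intervals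
    (h.intervalIntegrable_u ht i0 hε') (h.intervalIntegrable_u ht hε' i1)
  have hΦ := intervalIntegral.integral_add_adjacent_intervals (μ := volume) (a := 0) (b := ε)
    (c := 1) hF.intervalIntegrable hF.intervalIntegrable
  rw [hFint] at hΦ
  rw [h.mean_eq ht] at hm
  rw [h.integral_ut hF ht hε]
  have j0 := h.integral_u_nonneg ht hε'
  have j1 := h.integral_u_le ht (c := 1) i0 hε' hε.1.le
    fun z hz => h.le_one ht ⟨hz.1, hz.2.le.trans hε.2.le⟩
  have f0 : 0 ≤ ∫ x in (0 : ℝ)..ε, F x := intervalIntegral.integral_nonneg hε.1.le fun x _ => hF0 x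
  have f1 : ∫ x in (0 : ℝ)..ε, F x ≤ b * ε := by
    have := intervalIntegral.integral_mono_on hε.1.le (hF.intervalIntegrable (μ := volume))
      (intervalIntegrable_const (c := (b : ℝ))) fun x _ => hFb x
    simpa [mul_comm] using this
  have e0 := h.nonneg ht (Ioo_subset_Ioc_self hε)
  have e1 := h.le_one ht (Ioo_subset_Ioc_self hε)
  set g := ux 1 t
  set A := ∫ x in (0 : ℝ)..ε, u x t
  set B := ∫ x in (0 : ℝ)..ε, F x
  have hJ' : ∫ x in ε..1, u x t = 1 - m - A := by linarith
  have hΦ' : ∫ x in ε..1, F x = (b : ℝ) - 1 - B := by linarith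
  rw [hJ', hΦ']
  have e : g * (-((b : ℝ) - 1) * (1 - m - A) + ((b : ℝ) - 1 - B)) - (1 - ε * u ε t - (1 - m - A))
      - m * (g * ((b : ℝ) - 1) - 1) = g * (((b : ℝ) - 1) * A - B) + (ε * u ε t - A) := by ring
  rw [e]
  have k1 : |((b : ℝ) - 1) * A - B| ≤ 2 * b * ε := by
    have p1 : 0 ≤ ((b : ℝ) - 1) * A := mul_nonneg (by linarith) j0
    have p2 : ((b : ℝ) - 1) * A ≤ ((b : ℝ) - 1) * ε :=
      mul_le_mul_of_nonneg_left (by linarith) (by linarith)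
    have p3 : 0 ≤ (b : ℝ) * ε := mul_nonneg (by linarith) hε.1.le
    rw [abs_le]; constructor <;> nlinarith [hε.1]
  have k2 : |ε * u ε t - A| ≤ 2 * ε := by
    have p1 : 0 ≤ ε * u ε t := mul_nonneg hε.1.le e0
    have p2 : ε * u ε t ≤ ε := mul_le_of_le_one_right hε.1.le e1
    rw [abs_le]; constructor <;> linarith [hε.1]
  calc |g * (((b : ℝ) - 1) * A - B) + (ε * u ε t - A)|
      ≤ g * |((b : ℝ) - 1) * A - B| + |ε * u ε t - A| := by
        refine (abs_add_le _ _).trans_eq ?_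
        rw [abs_mul, abs_of_nonneg hg]
    _ ≤ g * (2 * b * ε) + 2 * ε := by gcongr
    _ = (g * (2 * b) + 2) * ε := by ring

theorem ux_one_eq_of_mean_const (h : IsFeedbackSolution b F u ux ut) (hb : 2 ≤ b) (hF : Monotone F)
    (hF0 : ∀ x, 0 ≤ F x) (hFb : ∀ x, F x ≤ b) (hFint : ∫ x in (0 : ℝ)..1, F x = (b : ℝ) - 1)
    {m : ℝ} (hm : ∀ t ∈ Ici (0 : ℝ), ∫ x in (0 : ℝ)..1, x * ux x t = m) {t : ℝ} (ht : 0 ≤ t) :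
    ux 1 t = ((b : ℝ) - 1)⁻¹ := by
  have hb' : (2 : ℝ) ≤ b := by exact_mod_cast hb
  have i0 : (0 : ℝ) ∈ Icc (0 : ℝ) 1 := ⟨le_rfl, zero_le_one⟩
  have i1 : (1 : ℝ) ∈ Icc (0 : ℝ) 1 := ⟨zero_le_one, le_rfl⟩
  have hm0 : 0 < m := by rw [← hm 0 self_mem_Ici]; exact h.mean_pos le_rfl
  set r : ℝ → ℝ := fun t => m * (ux 1 t * ((b : ℝ) - 1) - 1) with hr
  have hrc : ContinuousOn r (Ici 0) := by
    have := h.continuousOn_ux_one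
    exact continuousOn_const.mul ((this.mul continuousOn_const).sub continuousOn_const)
  have hr0 : r t = 0 := by
    refine eq_zero_of_forall_integral_eq_zero hrc (fun s t hs hst => ?_) ht
    have hsub : Icc s t ⊆ Ici 0 := fun _ hz => hs.trans hz.1
    obtain ⟨G, hG⟩ := isCompact_Icc.exists_bound_of_continuousOn (h.continuousOn_ux_one.mono hsub)
    have hri : IntervalIntegrable r volume s t := by
      refine ContinuousOn.intervalIntegrable (hrc.mono ?_)
      rwa [uIcc_of_le hst]
    -- The summand `1` bounds the change of `∫ x in ε..1, u x τ`, which stays in `[1 - m - ε, 1 -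
    -- m]`; the rest is the cutoff error integrated over time.
    have key : ∀ ε ∈ Ioo (0 : ℝ) 1,
        |∫ τ in s..t, r τ| ≤ (1 + (G * (2 * b) + 2) * (t - s)) * ε := by
      intro ε hε
      have hε' := Ioo_subset_Icc_self hε
      have hDi := h.intervalIntegrable_integral_ut hε hs hst
      have a1 : |∫ τ in s..t, ((∫ x in ε..1, ut x τ) - r τ)| ≤ (G * (2 * b) + 2) * ε * |t - s| := by
        refine intervalIntegral.norm_integral_le_of_norm_le_const
          (f := fun τ => (∫ x in ε..1, ut x τ) - r τ) fun τ hτ => ?_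
        rw [uIoc_of_le hst] at hτ
        have hτ0 : 0 ≤ τ := hs.trans hτ.1.le
        refine (h.abs_integral_ut_sub_le hb hF hF0 hFb hFint hτ0 (hm τ hτ0) hε).trans ?_
        have hGτ : ux 1 τ ≤ G := (le_abs_self _).trans (hG τ (Ioc_subset_Icc_self hτ))
        have := hε.1.le
        gcongr
      rw [intervalIntegral.integral_sub hDi hri, h.integral_integral_ut hε hs hst,
        abs_of_nonneg (sub_nonneg.2 hst)] at a1
      have a2 : |(∫ x in ε..1, u x t) - ∫ x in ε..1, u x s| ≤ ε := by
        have bound : ∀ τ, 0 ≤ τ → 1 - m - ε ≤ (∫ x in ε..1, u x τ) ∧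
            ∫ x in ε..1, u x τ ≤ 1 - m := by
          intro τ hτ
          have hJ := intervalIntegral.integral_add_adjacent_intervals
            (h.intervalIntegrable_u hτ i0 hε') (h.intervalIntegrable_u hτ hε' i1)
          have hmτ := hm τ hτ
          rw [h.mean_eq hτ] at hmτ
          have j0 := h.integral_u_nonneg hτ hε'
          have j1 := h.integral_u_le hτ (c := 1) i0 hε' hε.1.le
            fun z hz => h.le_one hτ ⟨hz.1, hz.2.le.trans hε.2.le⟩
          constructor <;> linarith
        have b1 := bound s hs
        have b2 := bound t (hs.trans hst)
        rw [abs_le]; constructor <;> linarith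
      rw [abs_le] at a1 a2 ⊢
      constructor <;> nlinarith
    set K := 1 + (G * (2 * b) + 2) * (t - s)
    have hlim : Tendsto (fun ε => K * ε) (𝓝[>] 0) (𝓝 0) := by
      have : Tendsto (fun ε => K * ε) (𝓝 0) (𝓝 (K * 0)) := (continuous_const_mul K).tendsto 0
      rw [mul_zero] at this
      exact this.mono_left nhdsWithin_le_nhds
    have := ge_of_tendsto hlim (by filter_upwards [Ioo_mem_nhdsGT one_pos] with ε hε using key ε hε)
    exact abs_nonpos_iff.1 this
  have := (mul_eq_zero.1 hr0).resolve_left hm0.ne'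
  exact eq_inv_of_mul_eq_one_left (by linarith)

/-! #### Integration along characteristics -/

/-- `u` is continuous in `t`, and Lipschitz in `x` uniformly in `t` because `ux` is bounded on the
compact rectangle. The boundary is included, which `hasFDerivAt_uncurry` does not cover. -/
theorem continuousOn_rectangle (h : IsFeedbackSolution b F u ux ut) {ε s t : ℝ} (hε : 0 < ε)
    (hs : 0 ≤ s) : ContinuousOn (fun p : ℝ × ℝ => u p.1 p.2) (Icc ε 1 ×ˢ Icc s t) := by
  obtain ⟨K, hK⟩ := (isCompact_Icc.prod isCompact_Icc).exists_bound_of_continuousOn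
    (h.cont_x.mono (rectangle_subset (t := t) hε hs))
  refine continuousOn_prod_of_continuousOn_lipschitzOnWith _ K.toNNReal (fun x hx τ hτ => ?_)
    fun τ hτ => ?_
  · exact (h.hasDeriv_t x ⟨hε.trans_le hx.1, hx.2⟩ τ (hs.trans hτ.1)).continuousWithinAt.mono
      fun _ hz => hs.trans hz.1
  · refine (convex_Icc ε 1).lipschitzOnWith_of_nnnorm_hasDerivWithin_le
      (f' := fun x => ux x τ) (fun x hx => ?_) fun x hx => ?_
    · exact (h.hasDeriv_x x ⟨hε.trans_le hx.1, hx.2⟩ τ (hs.trans hτ.1)).mono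
        fun _ hz => ⟨hε.trans_le hz.1, hz.2⟩
    · exact NNReal.le_toNNReal_of_coe_le (hK (x, τ) ⟨hx, hτ⟩)

theorem hasFDerivAt_uncurry (h : IsFeedbackSolution b F u ux ut) {x t : ℝ} (hx : x ∈ Ioo (0 : ℝ) 1)
    (ht : 0 < t) :
    HasFDerivAt (fun p : ℝ × ℝ => u p.1 p.2)
      ((ContinuousLinearMap.toSpanSingleton ℝ (ux x t)).coprod
        (ContinuousLinearMap.toSpanSingleton ℝ (ut x t))) (x, t) := by
  have hnhds : Ioo (0 : ℝ) 1 ×ˢ Ioi (0 : ℝ) ∈ 𝓝 (x, t) :=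
    prod_mem_nhds (Ioo_mem_nhds hx.1 hx.2) (Ioi_mem_nhds ht)
  have hnhds' : Ioc (0 : ℝ) 1 ×ˢ Ici (0 : ℝ) ∈ 𝓝 (x, t) :=
    mem_of_superset hnhds (prod_mono Ioo_subset_Ioc_self Ioi_subset_Ici_self)
  refine (hasStrictFDerivAt_uncurry_coprod (𝕜 := ℝ) (u := (x, t)) (f := u)
    (f₁ := fun x t => ContinuousLinearMap.toSpanSingleton ℝ (ux x t))
    (f₂ := fun x t => ContinuousLinearMap.toSpanSingleton ℝ (ut x t)) ?_ ?_ ?_ ?_).hasFDerivAt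
  · filter_upwards [hnhds] with p hp
    exact (h.hasDerivAt_x (le_of_lt hp.2) hp.1).hasFDerivAt
  · filter_upwards [hnhds] with p hp
    exact (h.hasDerivAt_t hp.2 (Ioo_subset_Ioc_self hp.1)).hasFDerivAt
  · exact (ContinuousLinearMap.toSpanSingletonCLE (𝕜 := ℝ) (E := ℝ)).continuous.continuousAt.comp
      (h.cont_x.continuousAt hnhds')
  · exact (ContinuousLinearMap.toSpanSingletonCLE (𝕜 := ℝ) (E := ℝ)).continuous.continuousAt.comp
      (h.cont_t.continuousAt hnhds')

/-- Characteristics run forward in time to the boundary `x = 1`, where `u` is known. Along them,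
`g(b-1) = 1` cancels `u` from the derivative of `x u`. -/
theorem eq_of_ux_one_eq (h : IsFeedbackSolution b F u ux ut) (hb : 2 ≤ b) (hF : Monotone F)
    (hFint : ∫ x in (0 : ℝ)..1, F x = (b : ℝ) - 1)
    (hg : ∀ t, 0 ≤ t → ux 1 t = ((b : ℝ) - 1)⁻¹) {y t : ℝ} (hy : y ∈ Ioc (0 : ℝ) 1) (ht : 0 ≤ t) :
    u y t = ((b : ℝ) - 1)⁻¹ * (y⁻¹ * ∫ s in (0 : ℝ)..y, F s) := by
  have hb' : (2 : ℝ) ≤ b := by exact_mod_cast hb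
  have hb1 : (b : ℝ) - 1 ≠ 0 := by linarith
  -- The characteristic `dt/dx = 1/x` through `(y, t)`.
  set γ : ℝ → ℝ := fun r => t + Real.log (r / y) with hγ
  have hγ0 : ∀ r ∈ Icc y 1, γ r ∈ Icc t (γ 1) := by
    intro r hr
    have hr0 : 0 < r := hy.1.trans_le hr.1
    refine ⟨le_add_of_nonneg_right (Real.log_nonneg ((one_le_div hy.1).2 hr.1)), ?_⟩
    have : 0 < r / y := div_pos hr0 hy.1
    have h2 : r / y ≤ 1 / y := div_le_div_of_nonneg_right hr.2 hy.1.le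
    simp only [hγ]
    gcongr
  have hγd : ∀ r, 0 < r → HasDerivAt γ r⁻¹ r := by
    intro r hr
    have h1 := (((hasDerivAt_id r).div_const y).log (div_pos hr hy.1).ne').const_add t
    refine h1.congr_deriv ?_
    have := hy.1.ne'
    simp only [id_eq]
    field_simp
  have hcont : ContinuousOn (fun r => r * u r (γ r)) (Icc y 1) := by
    refine continuousOn_id.mul ((h.continuousOn_rectangle (t := γ 1) hy.1 ht).comp
      (f := fun r => (r, γ r)) (continuousOn_id.prodMk fun r hr => ?_) fun r hr => ⟨hr, hγ0 r hr⟩)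
    exact (hγd r (hy.1.trans_le hr.1)).continuousAt.continuousWithinAt
  have hderiv : ∀ r ∈ Ioo y 1,
      HasDerivAt (fun r => r * u r (γ r)) (((b : ℝ) - 1)⁻¹ * F r) r := by
    intro r hr
    have hr0 : 0 < r := hy.1.trans hr.1
    have hγr : 0 < γ r :=
      add_pos_of_nonneg_of_pos ht (Real.log_pos ((one_lt_div hy.1).2 hr.1))
    have h1 := (h.hasFDerivAt_uncurry ⟨hr0, hr.2⟩ hγr).comp_hasDerivAt r
      (f := fun r => (r, γ r)) ((hasDerivAt_id r).prodMk (hγd r hr0))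
    refine ((hasDerivAt_id r).mul h1).congr_deriv ?_
    have heq := h.equation r ⟨hr0, hr.2.le⟩ (γ r) hγr.le
    rw [hg _ hγr.le] at heq
    simp only [ContinuousLinearMap.coprod_apply, ContinuousLinearMap.toSpanSingleton_apply,
      smul_eq_mul, id_eq, Function.comp_apply]
    field_simp at heq ⊢
    linarith
  have hFTC := intervalIntegral.integral_eq_sub_of_hasDerivAt_of_le hy.2 hcont hderiv
    ((hF.intervalIntegrable (μ := volume)).const_mul _)
  have hγ1 : 0 ≤ γ 1 := ht.trans (hγ0 1 ⟨hy.2, le_rfl⟩).1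
  have hγy : γ y = t := by simp [hγ, div_self hy.1.ne']
  rw [intervalIntegral.integral_const_mul, hγy, h.at_one _ hγ1, one_mul] at hFTC
  have hΦ := intervalIntegral.integral_add_adjacent_intervals (μ := volume) (a := 0) (b := y)
    (c := 1) hF.intervalIntegrable hF.intervalIntegrable
  rw [hFint] at hΦ
  have hy0 := hy.1.ne'
  have hΦ' : ∫ s in y..1, F s = (b : ℝ) - 1 - ∫ s in (0 : ℝ)..y, F s := by linarith
  rw [hΦ'] at hFTC
  field_simp at hFTC ⊢
  linarith

/-! #### Stationary solutions -/

theorem ux_eq_of_stationary (h : IsFeedbackSolution b F u ux ut)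
    (hst : ∀ t ∈ Ici (0 : ℝ), ∀ x ∈ Ioc (0 : ℝ) 1, u x t = u x 0) {x t : ℝ}
    (hx : x ∈ Ioc (0 : ℝ) 1) (ht : 0 ≤ t) : ux x t = ux x 0 :=
  (uniqueDiffOn_Ioc 0 1 x hx).eq_deriv _ (h.hasDeriv_x x hx t ht)
    ((h.hasDeriv_x x hx 0 self_mem_Ici).congr (fun y hy => hst t ht y hy) (hst t ht x hx))

theorem ut_eq_zero_of_stationary (h : IsFeedbackSolution b F u ux ut)
    (hst : ∀ t ∈ Ici (0 : ℝ), ∀ x ∈ Ioc (0 : ℝ) 1, u x t = u x 0) {x : ℝ}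
    (hx : x ∈ Ioc (0 : ℝ) 1) : ut x 0 = 0 :=
  (uniqueDiffWithinAt_Ici 0).eq_deriv _ (h.hasDeriv_t x hx 0 self_mem_Ici)
    ((hasDerivWithinAt_const 0 (Ici 0) (u x 0)).congr (fun t ht => hst t ht x hx) rfl)

/-- If `u_x(1)` were `0`, the equation would give `x u_x = 0` and a zero mean. Positivity is needed
because `C` is unique only among positive solutions. -/
theorem ux_one_pos_of_stationary (h : IsFeedbackSolution b F u ux ut)
    (hst : ∀ t ∈ Ici (0 : ℝ), ∀ x ∈ Ioc (0 : ℝ) 1, u x t = u x 0) : 0 < ux 1 0 := by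
  refine (h.ux_nonneg le_rfl ⟨one_pos, le_rfl⟩).lt_of_ne' fun h0 => ?_
  have h1 : ∫ x in (0 : ℝ)..1, x * ux x 0 = 0 := by
    rw [intervalIntegral.integral_of_le zero_le_one]
    refine setIntegral_eq_zero_of_forall_eq_zero fun x hx => ?_
    have := h.equation x hx 0 self_mem_Ici
    rwa [h.ut_eq_zero_of_stationary hst hx, h0, zero_mul, add_zero] at this
  exact (h.mean_pos le_rfl).ne' h1

/-- The equation is now `x u' + p u = g F` with `p = g(b-1)`; the integrating factor `x ^ (p - 1)`
turns it into `(x ^ p u)' = g F x ^ (p - 1)`. -/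
theorem eq_stationaryCDF_of_stationary (h : IsFeedbackSolution b F u ux ut) (hb : 2 ≤ b)
    (hF : Monotone F)
    (hst : ∀ t ∈ Ici (0 : ℝ), ∀ x ∈ Ioc (0 : ℝ) 1, u x t = u x 0) {x : ℝ}
    (hx : x ∈ Ioc (0 : ℝ) 1) : u x 0 = stationaryCDF b F (ux 1 0) x := by
  have hb' : (2 : ℝ) ≤ b := by exact_mod_cast hb
  have hg := h.ux_one_pos_of_stationary hst
  set g := ux 1 0 with hgdef
  set p := g * ((b : ℝ) - 1) with hp
  have hp0 : 0 < p := mul_pos hg (by linarith)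
  have hcont := h.continuousOn_weight_mul (w := fun x => x ^ p) (t := 0) le_rfl
    (Real.continuous_rpow_const hp0.le) (Real.zero_rpow hp0.ne')
  have hFTC := intervalIntegral.integral_eq_sub_of_hasDerivAt_of_le (a := 0) (b := x)
    (f := fun y => y ^ p * u y 0) (f' := fun s => g * (F s * s ^ (p - 1))) hx.1.le
    (hcont.mono (Icc_subset_Icc_right hx.2)) ?_ ?_
  · rw [intervalIntegral.integral_const_mul, Real.zero_rpow hp0.ne', zero_mul, sub_zero] at hFTC
    rw [stationaryCDF, mul_right_comm, hFTC, ← hp, mul_right_comm, ← Real.rpow_add hx.1,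
      add_neg_cancel, Real.rpow_zero, one_mul]
  · intro s hs
    have hs' : s ∈ Ioo (0 : ℝ) 1 := ⟨hs.1, hs.2.trans_le hx.2⟩
    refine ((Real.hasDerivAt_rpow_const (Or.inl hs.1.ne')).mul
      (h.hasDerivAt_x le_rfl hs')).congr_deriv ?_
    have heq := h.equation s (Ioo_subset_Ioc_self hs') 0 self_mem_Ici
    rw [h.ut_eq_zero_of_stationary hst (Ioo_subset_Ioc_self hs'), ← hgdef] at heq
    have hsp : s ^ p = s ^ (p - 1) * s := by
      rw [← Real.rpow_add_one hs.1.ne', sub_add_cancel]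
    rw [hsp]
    linear_combination (s ^ (p - 1)) * heq
  · refine IntervalIntegrable.const_mul ?_ _
    have h1 := intervalIntegral.intervalIntegrable_rpow' (a := 0) (b := x) (r := p - 1)
      (by linarith)
    rw [intervalIntegrable_iff] at h1 ⊢
    refine Integrable.bdd_mul (c := max |F 0| |F x|) h1 hF.measurable.aestronglyMeasurable ?_
    filter_upwards [ae_restrict_mem measurableSet_uIoc] with s hs
    rw [uIoc_of_le hx.1.le] at hs
    exact abs_le_max_abs_abs (hF hs.1.le) (hF hs.2)

end IsFeedbackSolution

end

end SeqFrag

end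

theorem theorem3 {b : ℕ} (hb : 2 ≤ b) (ν : Measure (Fin b → ℝ))
    (hν : SeqFrag.IsSplittingLaw ν) :
    ∃ C : ℝ,
      -- `C > 0` is the only solution of the normalization `u(1) = 1`, and `C = u'(1)`
      (∀ C' : ℝ, (0 < C' ∧ SeqFrag.stationaryCDF b (SeqFrag.expectedCount ν) C' 1 = 1) ↔ C' = C) ∧
      HasDerivWithinAt (SeqFrag.stationaryCDF b (SeqFrag.expectedCount ν) C) C (Iic 1) 1 ∧
      -- the random fragmentation process, with independent splittings of law `ν`
      (∀ {Ω : Type*} [MeasurableSpace Ω] (P : Measure Ω) [IsProbabilityMeasure P]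
        (V : ℕ → Ω → Fin b → ℝ), (∀ n, Measurable (V n)) → (∀ n, P.map (V n) = ν) →
        iIndepFun V P →
        ∀ᵐ ω ∂P,
          (SeqFrag.SpacingDistributionStationary (fun n => V n ω) ↔
            SeqFrag.MeanSpacingStationary (fun n => V n ω)) ∧
          ∀ u : ℝ → ℝ, SeqFrag.IsLimitingCDF (fun n => V n ω) u →
            ∀ x ∈ Ioc (0 : ℝ) 1,
              u x = SeqFrag.stationaryCDF b (SeqFrag.expectedCount ν) C x) ∧
      -- the feedback equation for the evolving spacing distribution
      (∀ u ux ut : ℝ → ℝ → ℝ,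
        SeqFrag.IsFeedbackSolution b (SeqFrag.expectedCount ν) u ux ut →
        ((∀ t ∈ Ici (0 : ℝ), ∀ x ∈ Ioc (0 : ℝ) 1, u x t = u x 0) ↔
          ∃ m : ℝ, ∀ t ∈ Ici (0 : ℝ), ∫ x in (0 : ℝ)..1, x * ux x t = m) ∧
        ((∀ t ∈ Ici (0 : ℝ), ∀ x ∈ Ioc (0 : ℝ) 1, u x t = u x 0) →
          ∀ t ∈ Ici (0 : ℝ), ux 1 t = C ∧
            ∀ x ∈ Ioc (0 : ℝ) 1,
              u x t = SeqFrag.stationaryCDF b (SeqFrag.expectedCount ν) C x)) := by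
  have := hν.prob
  refine ⟨((b : ℝ) - 1)⁻¹, hν.normalization_iff hb, hν.hasDerivWithinAt_stationaryCDF hb, ?_, ?_⟩
  · intro Ω _ P _ V hV hlaw hind
    exact SeqFrag.ae_stationary_iff hb hν P V hV hlaw hind
  · intro u ux ut h
    have hF := SeqFrag.expectedCount_mono (ν := ν)
    have hFint := hν.integral_expectedCount hb
    refine ⟨⟨fun hst => ⟨∫ x in (0 : ℝ)..1, x * ux x 0, fun t ht => ?_⟩, fun ⟨m, hm⟩ => ?_⟩,
      fun hst t ht => ?_⟩
    -- Writing the mean as `1 - ∫ u` makes it depend on `u` alone.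
    · rw [h.mean_eq ht, h.mean_eq le_rfl, intervalIntegral.integral_of_le zero_le_one,
        intervalIntegral.integral_of_le zero_le_one,
        setIntegral_congr_fun measurableSet_Ioc fun x hx => hst t ht x hx]
    · have hg : ∀ t, 0 ≤ t → ux 1 t = ((b : ℝ) - 1)⁻¹ := fun t ht =>
        h.ux_one_eq_of_mean_const hb hF SeqFrag.expectedCount_nonneg SeqFrag.expectedCount_le
          hFint hm ht
      intro t ht x hx
      rw [h.eq_of_ux_one_eq hb hF hFint hg hx ht, h.eq_of_ux_one_eq hb hF hFint hg hx le_rfl]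
    · have i1 : (1 : ℝ) ∈ Ioc (0 : ℝ) 1 := ⟨one_pos, le_rfl⟩
      -- With `g = ux 1 0`, `u = u_g` and `u(1) = 1` make `g` a positive solution of the
      -- normalization.
      have hC : ux 1 0 = ((b : ℝ) - 1)⁻¹ := (hν.normalization_iff hb _).1
        ⟨h.ux_one_pos_of_stationary hst, by
          rw [← h.eq_stationaryCDF_of_stationary hb hF hst i1, h.at_one 0 self_mem_Ici]⟩
      refine ⟨(h.ux_eq_of_stationary hst i1 ht).trans hC, fun x hx => ?_⟩
      rw [hst t ht x hx, h.eq_stationaryCDF_of_stationary hb hF hst hx, hC]
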